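/- Let $\mathbb{X}$ be a locally compact second-countable Hausdorff topological group with neutral element $e$ and left Haar measure $\lambda$, and suppose $\mathbb{X}$ is unimodular (i.e. $\lambda(Bx)=\lambda(B)$ for all Borel $B$ and $x\in\mathbb{X}$). Let $(\Omega,\mathcal{A},\mathbf{P})$ be a probability space with a jointly measurable, $\mathbf{P}$-preserving left action $(x,\omega)\mapsto\theta_x\omega$ of $\mathbb{X}$. Let $\mathbf{M}$ be the space of locally finite counting measures on $\mathbb{X}$ with the $\sigma$-algebra generated by the maps $\mu\mapsto\mu(B)$, $B$ Borel, and put $T_x\mu(B):=\mu(x^{-1}B)$. Let $\mathfrak{m}:\Omega\to\mathbf{M}$ be measurable, almost surely simple (every atom has mass $1$; $\mathfrak m$ is identified with its set of atoms), and flow-adapted: $\mathfrak{m}(\theta_x\omega)=T_x\mathfrak{m}(\omega)$ for all $x,\omega$. Suppose that $\mathbf{E}[\mathfrak{m}(\cdot)]$ is locally finite and not the zero measure, so that the intensity $\gamma=\mathbf{E}[\mathfrak{m}(B)]/\lambda(B)$ (for any Borel $B$ with $0<\lambda(B)<\infty$) lies in $(0,\infty)$. The Palm probability measure of $\mathfrak{m}$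 is $$\mathbf{P}^{\mathfrak{m}}(A)=\frac1\gamma\,\mathbf{E}\int_{\mathbb{X}}1_{\{\theta_x^{-1}\omega\in A\}}\,w(x)\,\mathfrak{m}(\omega,dx),\qquad A\in\mathcal{A},$$ where $w:\mathbb{X}\to[0,\infty)$ is any measurable function with $\int w\,d\lambda=1$. Suppose that $\mathfrak{m}$ is connectible in a flow-adapted way: there is a family of simple undirected graphs $\boldsymbol G(\omega)$, $\omega\in\Omega$, with vertices in $\mathbb{X}$, such that * for all $\omega\in\Omega$, $z\in\mathbb{X}$, the graph $\boldsymbol G(\theta_z\omega)$ is the left translate of $\boldsymbol G(\omega)$ by $z$; * almost surely $\boldsymbol G$ is connected (the empty graph being allowed), locally finite, and has vertex set $\mathfrak{m}$; * there are measurable $N:\Omega\to\mathbb{N}\cup\{\infty\}$ and $Y_i:\Omega\to\mathbb{X}$ such that almost surely $\mathfrak{m}=\sum_{i<N}\delta_{Y_i}$, and the event that $i,j<N$ and $\{Y_i,Y_j\}$ is an edge of $\boldsymbol G$ is measurable for all $i,j$. A network with mark space $\Xi$ (a complete separable metric space) is a connected locally finite graph $G$ with a mark in $\Xi$ for every vertex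 and for every pair $(v,g)$ of a vertex $v$ and an edge $g$ at $v$. Let $\mathcal{G}_*$ and $\mathcal{G}_{**}$ be the sets of isomorphism classes $[G,o]$ and $[G,o,v]$ of networks with one, respectively two, distinguished vertices, with the Borel $\sigma$-algebras of the local topology (two classes are close if, for some large $r$, the balls of radius $r$ around the distinguished vertices are isomorphic, respecting the distinguished vertices, with corresponding marks at distance at most $1/r$). Then the Palm version of $\mathfrak{m}$ is an $\mathbb{X}$-embedding of some unimodular random network. That is, there are a complete separable metric space $\Xi$, a measurable $[\boldsymbol{\Gamma},\boldsymbol{o}]:\Omega\to\mathcal{G}_*$ and a measurable $\psi:\mathcal{G}_*\to\mathbf{M}$ such that: 1. $\mathbf{P}^{\mathfrak{m}}$ is a probability measure and $[\boldsymbol\Gamma,\boldsymbol o]$ is unimodular under it: for all measurable $g:\mathcal{G}_{**}\to[0,\infty]$, $$\mathbf{E}^{\mathfrak{m}}\sum_{v\in V(\boldsymbol\Gamma)}g[\boldsymbol\Gamma,\boldsymbol o,v]=\mathbf{E}^{\mathfrak{m}}\sum_{v\in V(\boldsymbol\Gamma)}g[\boldsymbol\Gamma,v,\boldsymbol o];$$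 2. $e\in\psi[G,o]$ for all $[G,o]\in\mathcal{G}_*$; 3. there is a measurable $t:\mathcal{G}_{**}\to\mathbb{X}$ such that, for every network $G$ and all $o,v\in V(G)$, $\psi[G,v]=T_{t[G,o,v]^{-1}}\psi[G,o]$ and $t[G,v,o]=t[G,o,v]^{-1}$, and such that $\mathbf{P}^{\mathfrak{m}}$-almost surely $v\mapsto t[\boldsymbol\Gamma,\boldsymbol o,v]$ is a bijection from $V(\boldsymbol\Gamma)$ onto the support of $\psi[\boldsymbol\Gamma,\boldsymbol o]$; 4. $\mathfrak{m}=\psi[\boldsymbol\Gamma,\boldsymbol o]$ $\mathbf{P}^{\mathfrak{m}}$-almost surely. -/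

import Mathlib

open MeasureTheory Filter Set
open scoped ENNReal NNReal Topology

universe u v

namespace PalmNetwork

/-! ## Point processes on a locally compact second countable Hausdorff group -/

section PointProcess

/-- The space `𝐌` of locally finite counting measures on `X`.  As a subtype of `Measure X` it
carries the cylindrical sigma-algebra, generated by the maps `μ ↦ μ B`, `B` measurable. -/
def CountingMeasure (X : Type u) [TopologicalSpace X] [MeasurableSpace X] : Type u :=
  {μ : Measure X // IsLocallyFiniteMeasure μ ∧
    ∀ B : Set X, MeasurableSet B → ∃ n : ℕ∞, μ B = (n : ℝ≥0∞)}

instance (X : Type u) [TopologicalSpace X] [MeasurableSpace X] :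
    MeasurableSpace (CountingMeasure X) :=
  inferInstanceAs (MeasurableSpace (Subtype _))

instance (X : Type u) [TopologicalSpace X] [MeasurableSpace X] :
    CoeOut (CountingMeasure X) (Measure X) :=
  ⟨Subtype.val⟩

/-- The support of a locally finite counting measure, i.e. the set of its atoms. -/
def points {X : Type u} [TopologicalSpace X] [MeasurableSpace X] (μ : CountingMeasure X) :
    Set X :=
  {x | (μ : Measure X) {x} ≠ 0}

/-- Every atom has mass one. -/
def IsSimple {X : Type u} [TopologicalSpace X] [MeasurableSpace X] (μ : CountingMeasure X) :
    Prop :=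
  ∀ x ∈ points μ, (μ : Measure X) {x} = 1

/-- The translate `T_x μ`, with `T_x μ (B) = μ (x⁻¹ B)`. -/
noncomputable def leftTranslate {X : Type u} [Group X] [MeasurableSpace X] (x : X) (μ : Measure X) :
    Measure X :=
  μ.map (fun y => x * y)

/-- A point process `m` is flow-adapted if `m (θ_x ω) = T_x (m ω)` for all `x` and all `ω`; the
flow `θ_x ω` is the action `x • ω`. -/
def FlowAdapted {X : Type u} [Group X] [TopologicalSpace X] [MeasurableSpace X]
    {Ω : Type v} [MulAction X Ω] (m : Ω → CountingMeasure X) : Prop :=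
  ∀ (x : X) (ω : Ω), (m (x • ω) : Measure X) = leftTranslate x (m ω)

/-- The mean measure `Λ(B) = E[m(B)]`. -/
noncomputable def meanMeasure {X : Type u} [TopologicalSpace X] [MeasurableSpace X]
    {Ω : Type v} [MeasurableSpace Ω] (P : Measure Ω) (m : Ω → CountingMeasure X) : Measure X :=
  P.bind (fun ω => (m ω : Measure X))

/-- The intensity `E[m(K)] / haar(K)`, evaluated at one fixed compact set `K` with non-empty
interior; `intensity_eq` shows that any measurable set of positive finite Haar measure gives the
same value. -/
noncomputable def intensity {X : Type u} [Group X] [TopologicalSpace X] [LocallyCompactSpace X]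
    [MeasurableSpace X] {Ω : Type v} [MeasurableSpace Ω]
    (P : Measure Ω) (haar : Measure X) (m : Ω → CountingMeasure X) : ℝ≥0∞ :=
  meanMeasure P m (Classical.arbitrary (TopologicalSpace.PositiveCompacts X) : Set X) /
    haar (Classical.arbitrary (TopologicalSpace.PositiveCompacts X) : Set X)

/-- The Palm probability measure
`A ↦ (1 / intensity) * E [ ∫ 1_{θ_x⁻¹ ω ∈ A} w(x) m(ω, dx) ]`
computed with the weight function `w` (see `palm_apply`). -/
noncomputable def palm {X : Type u} [Group X] [TopologicalSpace X] [LocallyCompactSpace X]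
    [MeasurableSpace X] {Ω : Type v} [MeasurableSpace Ω] [MulAction X Ω]
    (P : Measure Ω) (haar : Measure X) (m : Ω → CountingMeasure X) (w : X → ℝ≥0) : Measure Ω :=
  (intensity P haar m)⁻¹ •
    P.bind (fun ω =>
      ((m ω : Measure X).withDensity (fun x => (w x : ℝ≥0∞))).map (fun x => x⁻¹ • ω))

set_option linter.unusedSectionVars false

variable {X : Type u} [Group X] [TopologicalSpace X] [IsTopologicalGroup X]
  [LocallyCompactSpace X] [SecondCountableTopology X] [T2Space X]
  [MeasurableSpace X] [BorelSpace X]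
  {Ω : Type v} [MeasurableSpace Ω]

theorem measurable_coe_measure {m : Ω → CountingMeasure X} (hm : Measurable m) :
    Measurable (fun ω => (m ω : Measure X)) :=
  measurable_subtype_coe.comp hm

theorem isSFiniteKernel_of_finite {κ : ProbabilityTheory.Kernel Ω X}
    (h : ∀ ω, κ ω univ < ∞) : ProbabilityTheory.IsSFiniteKernel κ := by
  classical
  let S : ℕ → Set Ω := fun k => (fun ω => κ ω univ) ⁻¹' (Ico (k : ℝ≥0∞) (k + 1))
  have hS : ∀ k, MeasurableSet (S k) := fun k =>
    (ProbabilityTheory.Kernel.measurable_coe κ MeasurableSet.univ) measurableSet_Ico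
  let κs : ℕ → ProbabilityTheory.Kernel Ω X := fun k =>
    ProbabilityTheory.Kernel.piecewise (hS k) κ 0
  have hfin : ∀ k, ProbabilityTheory.IsFiniteKernel (κs k) := by
    intro k
    refine ⟨⟨(k : ℝ≥0∞) + 1, by finiteness, fun ω => ?_⟩⟩
    simp only [κs, ProbabilityTheory.Kernel.piecewise_apply]
    split_ifs with hω
    · exact hω.2.le
    · simp
  have hsum : κ = ProbabilityTheory.Kernel.sum κs := by
    ext ω s hs
    rw [ProbabilityTheory.Kernel.sum_apply' _ _ hs]
    set k₀ := ⌊(κ ω univ).toNNReal⌋₊ with hk₀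
    have hcoe : κ ω univ = ((κ ω univ).toNNReal : ℝ≥0∞) := (ENNReal.coe_toNNReal (h ω).ne).symm
    have hmem : ∀ k, ω ∈ S k ↔ k = k₀ := by
      intro k
      simp only [S, mem_preimage, mem_Ico]
      rw [hcoe]
      have h1 : ((k : ℝ≥0∞) ≤ ((κ ω univ).toNNReal : ℝ≥0∞)) ↔
          ((k : ℝ≥0) ≤ (κ ω univ).toNNReal) := by exact_mod_cast Iff.rfl
      have h2 : (((κ ω univ).toNNReal : ℝ≥0∞) < (k : ℝ≥0∞) + 1) ↔
          ((κ ω univ).toNNReal < (k : ℝ≥0) + 1) := by exact_mod_cast Iff.rfl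
      rw [h1, h2, hk₀, eq_comm, Nat.floor_eq_iff (zero_le)]
    rw [tsum_eq_single k₀]
    · simp [κs, ProbabilityTheory.Kernel.piecewise_apply, (hmem k₀).2 rfl]
    · intro k hk
      have : ω ∉ S k := fun h' => hk ((hmem k).1 h')
      simp [κs, ProbabilityTheory.Kernel.piecewise_apply, this]
  rw [hsum]
  exact ProbabilityTheory.Kernel.isSFiniteKernel_sum

/-- A point process is an s-finite kernel, so integrals against it are measurable in `ω`. -/
theorem isSFiniteKernel_pointProcess {m : Ω → CountingMeasure X} (hm : Measurable m) :
    ProbabilityTheory.IsSFiniteKernel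
      (⟨fun ω => (m ω : Measure X), measurable_coe_measure hm⟩ :
        ProbabilityTheory.Kernel Ω X) := by
  set κ : ProbabilityTheory.Kernel Ω X :=
    ⟨fun ω => (m ω : Measure X), measurable_coe_measure hm⟩ with hκ
  let B : ℕ → Set X := disjointed (compactCovering X)
  have hB : ∀ n, MeasurableSet (B n) := fun n =>
    MeasurableSet.disjointed (fun k => (isCompact_compactCovering X k).measurableSet) n
  have hBfin : ∀ n ω, κ ω (B n) < ∞ := by
    intro n ω
    have : IsLocallyFiniteMeasure (m ω : Measure X) := (m ω).2.1
    exact lt_of_le_of_lt (measure_mono (disjointed_subset _ n))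
      (isCompact_compactCovering X n).measure_lt_top
  have hsum : κ = ProbabilityTheory.Kernel.sum (fun n => κ.restrict (hB n)) := by
    ext ω s hs
    rw [ProbabilityTheory.Kernel.sum_apply' _ _ hs]
    simp only [ProbabilityTheory.Kernel.restrict_apply' _ _ _ hs]
    rw [← measure_iUnion, ← inter_iUnion, iUnion_disjointed, iUnion_compactCovering, inter_univ]
    · exact fun i j hij => ((disjoint_disjointed _) hij).mono inter_subset_right inter_subset_right
    · exact fun n => hs.inter (hB n)
  rw [hsum]
  have : ∀ n, ProbabilityTheory.IsSFiniteKernel (κ.restrict (hB n)) := by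
    refine fun n => isSFiniteKernel_of_finite fun ω => ?_
    rw [ProbabilityTheory.Kernel.restrict_apply' _ _ _ MeasurableSet.univ, univ_inter]
    exact hBfin n ω
  exact ProbabilityTheory.Kernel.isSFiniteKernel_sum

theorem meanMeasure_apply {P : Measure Ω} {m : Ω → CountingMeasure X} (hm : Measurable m)
    {B : Set X} (hB : MeasurableSet B) :
    meanMeasure P m B = ∫⁻ ω, (m ω : Measure X) B ∂P :=
  Measure.bind_apply hB (measurable_coe_measure hm).aemeasurable

/-- The defining formula of the Palm probability measure. -/
theorem palm_apply [MulAction X Ω] [MeasurableSMul₂ X Ω] {P : Measure Ω} {haar : Measure X}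
    {m : Ω → CountingMeasure X} (hm : Measurable m) {w : X → ℝ≥0} (hw : Measurable w)
    {A : Set Ω} (hA : MeasurableSet A) :
    palm P haar m w A = (intensity P haar m)⁻¹ *
      ∫⁻ ω, ∫⁻ x, A.indicator (fun _ => (w x : ℝ≥0∞)) (x⁻¹ • ω) ∂(m ω : Measure X) ∂P := by
  have := isSFiniteKernel_pointProcess hm
  have hw' : Measurable fun x => (w x : ℝ≥0∞) := hw.coe_nnreal_ennreal
  have hx : ∀ ω : Ω, Measurable fun x : X => x⁻¹ • ω := fun ω =>
    measurable_inv.smul_const ω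
  have hval : ∀ (ω : Ω) {A : Set Ω}, MeasurableSet A →
      ((m ω : Measure X).withDensity (fun x => (w x : ℝ≥0∞))).map (fun x => x⁻¹ • ω) A =
        ∫⁻ x, A.indicator (fun _ => (w x : ℝ≥0∞)) (x⁻¹ • ω) ∂(m ω : Measure X) := by
    intro ω A hA
    rw [Measure.map_apply (hx ω) hA, withDensity_apply _ (hx ω hA),
      ← lintegral_indicator (hx ω hA)]
    rfl
  have hmeas : Measurable fun ω =>
      ((m ω : Measure X).withDensity (fun x => (w x : ℝ≥0∞))).map (fun x => x⁻¹ • ω) := by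
    refine Measure.measurable_of_measurable_coe _ fun A hA => ?_
    simp only [hval _ hA]
    have hf : Measurable (Function.uncurry fun (ω : Ω) (x : X) =>
        A.indicator (fun _ => (w x : ℝ≥0∞)) (x⁻¹ • ω)) := by
      have hset : MeasurableSet {p : Ω × X | p.2⁻¹ • p.1 ∈ A} :=
        (measurable_snd.inv.smul measurable_fst) hA
      exact (hw'.comp measurable_snd).indicator hset
    exact hf.lintegral_kernel_prod_right (κ :=
      (⟨fun ω => (m ω : Measure X), measurable_coe_measure hm⟩ : ProbabilityTheory.Kernel Ω X))
  rw [palm, Measure.smul_apply, smul_eq_mul, Measure.bind_apply hA hmeas.aemeasurable]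
  simp only [hval _ hA]

/-- The intensity does not depend on the set used to compute it. -/
theorem intensity_eq [MulAction X Ω] [MeasurableSMul₂ X Ω] {P : Measure Ω}
    [SMulInvariantMeasure X Ω P] {haar : Measure X} [haar.IsHaarMeasure]
    {m : Ω → CountingMeasure X} (hm : Measurable m) (hfa : FlowAdapted m)
    [IsLocallyFiniteMeasure (meanMeasure P m)]
    {B : Set X} (h0 : haar B ≠ 0) (h1 : haar B ≠ ∞) :
    intensity P haar m = meanMeasure P m B / haar B := by
  have : (meanMeasure P m).IsMulLeftInvariant := by
    refine ⟨fun x => ?_⟩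
    ext B hB
    have hpre : MeasurableSet ((fun y => x * y) ⁻¹' B) := measurable_const_mul x hB
    rw [Measure.map_apply (measurable_const_mul x) hB, meanMeasure_apply hm hpre,
      meanMeasure_apply hm hB]
    have hB' : Measurable fun ω => (m ω : Measure X) B :=
      (Measure.measurable_coe hB).comp (measurable_coe_measure hm)
    rw [← (measurePreserving_smul x P).lintegral_comp hB']
    refine lintegral_congr fun ω => ?_
    rw [hfa x ω, leftTranslate, Measure.map_apply (measurable_const_mul x) hB]
  have h := Measure.isMulLeftInvariant_eq_smul (meanMeasure P m) haar
  set c := Measure.haarScalarFactor (meanMeasure P m) haar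
  have key : ∀ C : Set X, haar C ≠ 0 → haar C ≠ ∞ → meanMeasure P m C / haar C = c := by
    intro C hC0 hC1
    rw [h, Measure.smul_apply, ENNReal.smul_def, smul_eq_mul]
    exact ENNReal.mul_div_cancel_right hC0 hC1
  rw [intensity, key B h0 h1, key]
  · exact (Measure.measure_pos_of_nonempty_interior haar
      (Classical.arbitrary (TopologicalSpace.PositiveCompacts X)).interior_nonempty).ne'
  · exact (Classical.arbitrary (TopologicalSpace.PositiveCompacts X)).isCompact.measure_lt_top.ne

end PointProcess

/-! ## Connectibility -/

/-- The point process `m` is connectible in a flow-adapted way: there is a random graph `G` with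
vertices in `X` (a subgraph of the complete simple graph on `X`) which is flow-adapted, almost
surely connected and locally finite with vertex set `m`, and measurable, in the sense that for some
measurable enumeration `m = ∑_{i < N} δ_{Y i}` the events `{Y i, Y j} ∈ E(G)` are measurable.  The
empty graph counts as connected, since `m` may be empty with positive probability. -/
def Connectible {X : Type u} [Group X] [TopologicalSpace X] [MeasurableSpace X]
    {Ω : Type v} [MeasurableSpace Ω] [MulAction X Ω] (P : Measure Ω)
    (m : Ω → CountingMeasure X) : Prop :=
  ∃ G : Ω → (⊤ : SimpleGraph X).Subgraph,
    (∀ (z : X) (ω : Ω),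
      (∀ x : X, x ∈ (G ω).verts ↔ z * x ∈ (G (z • ω)).verts) ∧
      (∀ x y : X, (G ω).Adj x y ↔ (G (z • ω)).Adj (z * x) (z * y))) ∧
    (∀ᵐ ω ∂P, (G ω).coe.Preconnected ∧ (∀ x ∈ (G ω).verts, ((G ω).neighborSet x).Finite) ∧
      (G ω).verts = points (m ω)) ∧
    ∃ (N : Ω → ℕ∞) (Y : ℕ → Ω → X), Measurable N ∧ (∀ i, Measurable (Y i)) ∧
      (∀ᵐ ω ∂P, (m ω : Measure X) =
        Measure.sum (fun i : {i : ℕ // (i : ℕ∞) < N ω} => Measure.dirac (Y i ω))) ∧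
      ∀ i j : ℕ, MeasurableSet {ω | (i : ℕ∞) < N ω ∧ (j : ℕ∞) < N ω ∧ (G ω).Adj (Y i ω) (Y j ω)}

/-! ## Networks -/

section Network

/-- A network with mark space `Ξ`: a connected locally finite graph with marks.  The edge mark of
the pair `(v, {v, w})` is `edgeMark v w`; only its values at adjacent `v`, `w` are meaningful. -/
structure Network (Ξ : Type u) where
  V : Type u
  graph : SimpleGraph V
  connected : graph.Connected
  locallyFinite : ∀ v, (graph.neighborSet v).Finite
  vertexMark : V → Ξ
  edgeMark : V → V → Ξ

/-- A network with `k` distinguished vertices. -/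
structure PointedNetwork (Ξ : Type u) (k : ℕ) extends Network Ξ where
  root : Fin k → V

/-- Isomorphism of networks, preserving marks and distinguished vertices. -/
def PointedNetwork.Isomorphic {Ξ : Type u} {k : ℕ} (A B : PointedNetwork Ξ k) : Prop :=
  ∃ φ : A.graph ≃g B.graph,
    (∀ v, A.vertexMark v = B.vertexMark (φ v)) ∧
    (∀ v w, A.graph.Adj v w → A.edgeMark v w = B.edgeMark (φ v) (φ w)) ∧
    ∀ i, φ (A.root i) = B.root i

instance PointedNetwork.setoid (Ξ : Type u) (k : ℕ) : Setoid (PointedNetwork Ξ k) where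
  r := PointedNetwork.Isomorphic
  iseqv :=
    { refl := fun _ => ⟨SimpleGraph.Iso.refl, fun _ => rfl, fun _ _ _ => rfl, fun _ => rfl⟩
      symm := by
        rintro A B ⟨φ, h1, h2, h3⟩
        refine ⟨φ.symm, fun v => ?_, fun v w hvw => ?_, fun i => ?_⟩
        · rw [h1, RelIso.apply_symm_apply]
        · rw [h2 _ _ (φ.symm.map_rel_iff.2 hvw), RelIso.apply_symm_apply,
            RelIso.apply_symm_apply]
        · rw [← h3 i, RelIso.symm_apply_apply]
      trans := by
        rintro A B C ⟨φ, h1, h2, h3⟩ ⟨ψ, g1, g2, g3⟩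
        refine ⟨φ.trans ψ, fun v => ?_, fun v w hvw => ?_, fun i => ?_⟩
        · rw [h1, g1]; rfl
        · rw [h2 _ _ hvw, g2 _ _ (φ.map_rel_iff.2 hvw)]; rfl
        · exact (congrArg ψ (h3 i)).trans (g3 i) }

/-- Isomorphism classes of networks with `k` distinguished vertices: `NetworkClass Ξ 1` is `𝒢_*`
and `NetworkClass Ξ 2` is `𝒢_**`. -/
def NetworkClass (Ξ : Type u) (k : ℕ) : Type (u + 1) :=
  Quotient (PointedNetwork.setoid Ξ k)

/-- The class `[G, o]`. -/
def rooted {Ξ : Type u} (G : Network Ξ) (o : G.V) : NetworkClass Ξ 1 :=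
  Quotient.mk _ { G with root := ![o] }

/-- The class `[G, o, v]`. -/
def birooted {Ξ : Type u} (G : Network Ξ) (o v : G.V) : NetworkClass Ξ 2 :=
  Quotient.mk _ { G with root := ![o, v] }

/-- The ball of radius `⌈r⌉` around the distinguished vertices. -/
noncomputable def PointedNetwork.ball {Ξ : Type u} {k : ℕ} (A : PointedNetwork Ξ k) (r : ℝ) :
    Set A.V :=
  {v | ∃ i, A.graph.dist (A.root i) v ≤ ⌈r⌉₊}

/-- `A` and `B` are `r`-close: the balls of radius `r` around the distinguished vertices are
isomorphic by an isomorphism of graphs which respects the distinguished vertices and moves marks by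
at most `1 / r`. -/
def PointedNetwork.Close {Ξ : Type u} [MetricSpace Ξ] {k : ℕ} (r : ℝ)
    (A B : PointedNetwork Ξ k) : Prop :=
  ∃ φ : A.graph.induce (A.ball r) ≃g B.graph.induce (B.ball r),
    (∀ i (v : A.ball r), (v : A.V) = A.root i → (φ v : B.V) = B.root i) ∧
    (∀ v : A.ball r, dist (A.vertexMark v) (B.vertexMark (φ v)) ≤ 1 / r) ∧
    ∀ v w : A.ball r, A.graph.Adj v w →
      dist (A.edgeMark v w) (B.edgeMark (φ v) (φ w)) ≤ 1 / r

/-- The local topology on isomorphism classes: `U` is open if for each `[A] ∈ U` there is `R` such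
that all `[B]` which are `r`-close to `[A]` for some `r > R` lie in `U`.  This says that `U`
contains a ball around each of its points for the distance `2 ^ (-α)`, where
`α = sup {r > 0 | A and B are r-close}`. -/
instance NetworkClass.topologicalSpace (Ξ : Type u) [MetricSpace Ξ] (k : ℕ) :
    TopologicalSpace (NetworkClass Ξ k) where
  IsOpen U := ∀ A : PointedNetwork Ξ k, Quotient.mk _ A ∈ U →
    ∃ R : ℝ, 0 < R ∧ ∀ r > R, ∀ B : PointedNetwork Ξ k, A.Close r B → Quotient.mk _ B ∈ U
  isOpen_univ := fun _ _ => ⟨1, one_pos, fun _ _ _ _ => mem_univ _⟩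
  isOpen_inter := by
    intro U V hU hV A hA
    obtain ⟨R, hR, h⟩ := hU A hA.1
    obtain ⟨S, _, h'⟩ := hV A hA.2
    exact ⟨max R S, lt_max_of_lt_left hR, fun r hr B hB =>
      ⟨h r ((le_max_left _ _).trans_lt hr) B hB, h' r ((le_max_right _ _).trans_lt hr) B hB⟩⟩
  isOpen_sUnion := by
    rintro 𝒰 h𝒰 A ⟨U, hU, hA⟩
    obtain ⟨R, hR, h⟩ := h𝒰 U hU A hA
    exact ⟨R, hR, fun r hr B hB => ⟨U, hU, h r hr B hB⟩⟩

instance NetworkClass.measurableSpace (Ξ : Type u) [MetricSpace Ξ] (k : ℕ) :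
    MeasurableSpace (NetworkClass Ξ k) :=
  borel _

theorem birooted_eq {Ξ : Type u} {A B : PointedNetwork Ξ 1} (φ : A.graph ≃g B.graph)
    (h1 : ∀ v, A.vertexMark v = B.vertexMark (φ v))
    (h2 : ∀ v w, A.graph.Adj v w → A.edgeMark v w = B.edgeMark (φ v) (φ w)) (v w : A.V) :
    birooted A.toNetwork v w = birooted B.toNetwork (φ v) (φ w) := by
  refine Quotient.sound ⟨φ, h1, h2, fun i => ?_⟩
  fin_cases i <;> rfl

/-- `∑_{v ∈ V(G)} g [G, o, v]` as a function of `[G, o]`. -/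
noncomputable def massOut {Ξ : Type u} (g : NetworkClass Ξ 2 → ℝ≥0∞) :
    NetworkClass Ξ 1 → ℝ≥0∞ :=
  Quotient.lift (fun A : PointedNetwork Ξ 1 =>
      ∑' v : A.V, g (birooted A.toNetwork (A.root 0) v)) (by
    rintro A B ⟨φ, h1, h2, h3⟩
    rw [← Equiv.tsum_eq φ.toEquiv]
    refine tsum_congr fun v => ?_
    rw [birooted_eq φ h1 h2, h3]
    rfl)

/-- `∑_{v ∈ V(G)} g [G, v, o]` as a function of `[G, o]`. -/
noncomputable def massIn {Ξ : Type u} (g : NetworkClass Ξ 2 → ℝ≥0∞) :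
    NetworkClass Ξ 1 → ℝ≥0∞ :=
  Quotient.lift (fun A : PointedNetwork Ξ 1 =>
      ∑' v : A.V, g (birooted A.toNetwork v (A.root 0))) (by
    rintro A B ⟨φ, h1, h2, h3⟩
    rw [← Equiv.tsum_eq φ.toEquiv]
    refine tsum_congr fun v => ?_
    rw [birooted_eq φ h1 h2, h3]
    rfl)

/-- `Γ = [G, o]` is a unimodular random network on the probability space `(Ω, Q)`. -/
structure IsUnimodularNetwork {Ξ : Type u} [MetricSpace Ξ] {Ω : Type v} [MeasurableSpace Ω]
    (Q : Measure Ω) (Γ : Ω → NetworkClass Ξ 1) : Prop where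
  isProbabilityMeasure : IsProbabilityMeasure Q
  measurable : Measurable Γ
  massTransport : ∀ g : NetworkClass Ξ 2 → ℝ≥0∞, Measurable g →
    ∫⁻ ω, massOut g (Γ ω) ∂Q = ∫⁻ ω, massIn g (Γ ω) ∂Q

/-- `ψ : 𝒢_* → 𝐌` is an `X`-embedding of the random network `Γ` with respect to `Q`. -/
structure IsEmbedding {X : Type u} [Group X] [TopologicalSpace X] [MeasurableSpace X]
    {Ξ : Type u} [MetricSpace Ξ] {Ω : Type v} [MeasurableSpace Ω] (Q : Measure Ω)
    (Γ : Ω → NetworkClass Ξ 1) (ψ : NetworkClass Ξ 1 → CountingMeasure X) : Prop where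
  measurable : Measurable ψ
  one_mem : ∀ a, (1 : X) ∈ points (ψ a)
  exists_transition : ∃ t : NetworkClass Ξ 2 → X, Measurable t ∧
    (∀ (G : Network Ξ) (o v : G.V),
      (ψ (rooted G v) : Measure X) = leftTranslate (t (birooted G o v))⁻¹ (ψ (rooted G o)) ∧
      t (birooted G v o) = (t (birooted G o v))⁻¹) ∧
    ∀ᵐ ω ∂Q, ∀ (G : Network Ξ) (o : G.V), Γ ω = rooted G o →
      BijOn (fun v => t (birooted G o v)) univ (points (ψ (Γ ω)))

end Network

end PalmNetwork

open PalmNetwork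

set_option linter.unusedSectionVars false

/-! Each edge from `x` to `y` of the given graph is marked with the displacement `x⁻¹ * y`; the mark
space is the group itself, equipped with a complete metric. Displacements do not change under left
translation, so the isomorphism class of the network carries no absolute position. Yet the marks
along any walk from the root telescope, and when the root sits at the neutral element their product
is the position of the end vertex (`walkProd_pointNetwork`). The rooted class therefore determines
the whole configuration. This defines the transition `t` (product of marks along a walk) and the
embedding `ψ` (image of the vertices under `t`) on every network whose products are independent of
the walk and whose image is locally finite. Every other network is sent to the Dirac measure at `1`
with `t = 1`. Both conditions are stable under changing the root, so the transition identities hold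
for every network, not only almost surely.

Unimodularity is the mass transport principle for the Palm measure. Inserting a second copy of the
weight `w`, integrating over the group and shifting diagonally exchanges the roles of two points
(`lintegral_swap_weight`); this uses right and inversion invariance of Haar measure. The outcome is
the exchange formula `palm_exchange`, which replaces `f ω v` by `f (v⁻¹ • ω) v⁻¹`. Translation by
`v⁻¹` is an isomorphism of networks taking the roots `(v, 1)` to `(1, v⁻¹)`, so for `f ω v = g [Γ,
1, v]` the two sides of the exchange formula are the outgoing and the incoming mass.

Measurability is needed in two directions. Maps defined on network classes are controlled by
openness: a walk, or a finite set of vertices, persists in all sufficiently close networks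
(`measurable_transportClass`, `measurable_vertexMeasure`). For maps into network classes, balls are
finite and marks can be approximated from a dense sequence, so an open set is reached through
countably many finite patterns (`measurable_networkClass`).

Finally, the hypotheses hold almost surely under `P`, the conclusions under the Palm measure, and
only invariant null sets pass directly from one to the other (`palm_eq_zero_of_invariant`).
Averaging over the group with Haar measure replaces the almost sure event by an invariant one and
the edge set by a measurable set that is correct on all of it (`exists_isGoodEvent`). -/

namespace PalmNetwork

/-! ### Metrizability and Haar measure of the group -/

section Group

variable {X : Type*} [Group X] [TopologicalSpace X] [IsTopologicalGroup X]
  [LocallyCompactSpace X] [SecondCountableTopology X] [T2Space X]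

/-- A locally compact group is complete in its right uniformity, and first countability at `1` makes
this uniformity countably generated. The result lets the group serve as its own mark space. -/
theorem isCompletelyMetrizableSpace_of_locallyCompact_group (X : Type*) [Group X]
    [TopologicalSpace X] [IsTopologicalGroup X] [LocallyCompactSpace X]
    [SecondCountableTopology X] [T2Space X] :
    TopologicalSpace.IsCompletelyMetrizableSpace X := by
  let _ : UniformSpace X := IsTopologicalGroup.rightUniformSpace X
  have : IsRightUniformGroup X := ⟨rfl⟩
  have : CompleteSpace X := IsRightUniformGroup.completeSpace_of_weaklyLocallyCompactSpace
  have : (uniformity X).IsCountablyGenerated := by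
    rw [uniformity_eq_comap_nhds_one]
    infer_instance
  infer_instance

variable [MeasurableSpace X] [BorelSpace X]

theorem isMulRightInvariant_of_image {haar : Measure X}
    (h : ∀ (x : X) (B : Set X), MeasurableSet B → haar ((fun y => y * x) '' B) = haar B) :
    haar.IsMulRightInvariant := by
  refine ⟨fun x => ?_⟩
  ext B hB
  rw [Measure.map_apply (measurable_mul_const x) hB, ← h x⁻¹ B hB]
  congr 1
  ext y
  simp

/-- Inversion turns right invariance into left invariance, so by uniqueness `haar.inv` is a multiple
`c` of `haar`. Evaluating both at a symmetric compact set of positive measure forces `c = 1`. -/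
theorem isInvInvariant_of_isMulRightInvariant (haar : Measure X) [haar.IsHaarMeasure]
    [haar.IsMulRightInvariant] : haar.IsInvInvariant := by
  have hfin : IsFiniteMeasureOnCompacts haar.inv := by
    refine ⟨fun K hK => ?_⟩
    rw [Measure.inv_apply]
    exact hK.inv.measure_lt_top
  have hc := Measure.isMulLeftInvariant_eq_smul haar.inv haar
  set c := Measure.haarScalarFactor haar.inv haar
  refine ⟨?_⟩
  let K := Classical.arbitrary (TopologicalSpace.PositiveCompacts X)
  let L : Set X := (K : Set X) ∪ (K : Set X)⁻¹
  have hLc : IsCompact L := K.isCompact.union K.isCompact.inv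
  have hL0 : haar L ≠ 0 := by
    refine ((Measure.measure_pos_of_nonempty_interior haar K.interior_nonempty).trans_le
      (measure_mono subset_union_left)).ne'
  have hLi : L⁻¹ = L := by simp [L, union_comm]
  have h1 : haar.inv L = haar L := by rw [Measure.inv_apply, hLi]
  rw [hc, Measure.smul_apply, ENNReal.smul_def, smul_eq_mul] at h1
  have h2 : (c : ℝ≥0∞) = 1 :=
    (ENNReal.mul_left_inj hL0 hLc.measure_lt_top.ne).1 (h1.trans (one_mul _).symm)
  have h3 : c = 1 := by exact_mod_cast h2
  rw [hc, h3, one_smul]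

end Group

/-! ### Atoms of locally finite counting measures -/

section Atoms

variable {X : Type u} [TopologicalSpace X] [SecondCountableTopology X] [T2Space X]
  [LocallyCompactSpace X] [MeasurableSpace X] [BorelSpace X]

/-- A locally finite counting measure is purely atomic. -/
theorem exists_mem_points_of_measure_ne_zero (μ : CountingMeasure X) {S : Set X}
    (h : (μ : Measure X) S ≠ 0) : ∃ x ∈ points μ, x ∈ S := by
  by_contra! hcon
  have hlf : IsLocallyFiniteMeasure (μ : Measure X) := μ.2.1
  refine h (measure_null_of_locally_null S fun x hx => ?_)
  have hx0 : (μ : Measure X) {x} = 0 := by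
    by_contra h0
    exact hcon x h0 hx
  -- A point that is no atom has, by outer regularity, a neighbourhood of mass below one;
  -- integrality of the values makes that mass zero.
  obtain ⟨U, hxU, hUo, hU⟩ := Set.exists_isOpen_lt_of_lt {x} 1 (hx0.trans_lt zero_lt_one)
  refine ⟨U, mem_nhdsWithin_of_mem_nhds (hUo.mem_nhds (hxU rfl)), ?_⟩
  obtain ⟨n, hn⟩ := μ.2.2 U hUo.measurableSet
  rw [hn] at hU ⊢
  have hn1 : n < 1 := by exact_mod_cast hU
  rw [Order.lt_one_iff.1 hn1]
  simp

theorem measure_ne_zero_iff_exists_mem_points (μ : CountingMeasure X) {S : Set X} :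
    (μ : Measure X) S ≠ 0 ↔ ∃ x ∈ points μ, x ∈ S := by
  refine ⟨exists_mem_points_of_measure_ne_zero μ, ?_⟩
  rintro ⟨x, hx, hxS⟩ h0
  exact hx (measure_mono_null (singleton_subset_iff.2 hxS) h0)

theorem countable_points (μ : CountingMeasure X) : (points μ).Countable := by
  have hlf : IsLocallyFiniteMeasure (μ : Measure X) := μ.2.1
  have h := Measure.countable_meas_pos_of_disjoint_iUnion (μ := (μ : Measure X))
    (As := fun x : X => {x}) (fun x => measurableSet_singleton x)
    (fun x y hxy => disjoint_singleton.2 hxy)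
  exact h.mono fun x hx => pos_iff_ne_zero.2 hx

theorem measurableSet_points (μ : CountingMeasure X) : MeasurableSet (points μ) :=
  (countable_points μ).measurableSet

theorem measure_compl_points (μ : CountingMeasure X) : (μ : Measure X) (points μ)ᶜ = 0 := by
  by_contra h
  obtain ⟨x, hx, hx'⟩ := exists_mem_points_of_measure_ne_zero μ h
  exact hx' hx

/-- A simple counting measure is the sum of the Dirac measures at its atoms. -/
theorem IsSimple.eq_sum_dirac {μ : CountingMeasure X} (h : IsSimple μ) :
    (μ : Measure X) = Measure.sum fun x : points μ => Measure.dirac (x : X) := by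
  have hc : Countable (points μ) := (countable_points μ).to_subtype
  ext S hS
  rw [← measure_inter_add_sdiff S (measurableSet_points μ),
    measure_mono_null (sdiff_subset_compl _ _) (measure_compl_points μ), add_zero,
    Measure.sum_apply _ hS]
  have h1 : S ∩ points μ = ⋃ x : points μ, S ∩ {(x : X)} := by
    ext y
    simp only [mem_inter_iff, mem_iUnion, mem_singleton_iff, Subtype.exists, exists_prop]
    aesop
  rw [h1, measure_iUnion]
  · refine tsum_congr fun x => ?_
    rw [Measure.dirac_apply' _ hS]
    by_cases hx : (x : X) ∈ S
    · rw [inter_eq_self_of_subset_right (singleton_subset_iff.2 hx), h x x.2,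
        indicator_of_mem hx, Pi.one_apply]
    · rw [inter_singleton_eq_empty.2 hx, measure_empty, indicator_of_notMem hx]
  · intro x y hxy
    refine Disjoint.mono inter_subset_right inter_subset_right ?_
    exact disjoint_singleton.2 fun h => hxy (Subtype.ext h)
  · exact fun x => hS.inter (measurableSet_singleton _)

theorem IsSimple.lintegral_eq_tsum {μ : CountingMeasure X} (h : IsSimple μ) {f : X → ℝ≥0∞}
    (hf : Measurable f) : ∫⁻ x, f x ∂(μ : Measure X) = ∑' x : points μ, f x := by
  rw [h.eq_sum_dirac, lintegral_sum_measure]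
  exact tsum_congr fun x => lintegral_dirac' _ hf

end Atoms

/-! ### The Palm measure and the mass transport principle -/

section Palm

open ProbabilityTheory

variable {X : Type u} [Group X] [TopologicalSpace X] [IsTopologicalGroup X]
  [LocallyCompactSpace X] [SecondCountableTopology X] [T2Space X]
  [MeasurableSpace X] [BorelSpace X]
  {Ω : Type v} [MeasurableSpace Ω]

/-- A point process as a kernel. -/
def pointKernel {m : Ω → CountingMeasure X} (hm : Measurable m) : Kernel Ω X :=
  ⟨fun ω => (m ω : Measure X), measurable_coe_measure hm⟩

instance {m : Ω → CountingMeasure X} (hm : Measurable m) : IsSFiniteKernel (pointKernel hm) :=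
  isSFiniteKernel_pointProcess hm

theorem sFinite_pointProcess {m : Ω → CountingMeasure X} (hm : Measurable m) (ω : Ω) :
    SFinite (m ω : Measure X) :=
  inferInstanceAs (SFinite (pointKernel hm ω))

theorem measurable_lintegral_pointProcess {S : Type*} [MeasurableSpace S]
    {m : Ω → CountingMeasure X} (hm : Measurable m) {ρ : S → Ω} (hρ : Measurable ρ)
    {f : S → X → ℝ≥0∞} (hf : Measurable (Function.uncurry f)) :
    Measurable fun s => ∫⁻ x, f s x ∂(m (ρ s) : Measure X) :=
  hf.lintegral_kernel_prod_right (κ := pointKernel (hm.comp hρ))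

/-- The existence of a point of the process with a measurable property is measurable. -/
theorem measurableSet_exists_mem_points {S : Type*} [MeasurableSpace S]
    {m : Ω → CountingMeasure X} (hm : Measurable m) {ρ : S → Ω} (hρ : Measurable ρ)
    {T : Set (S × X)} (hT : MeasurableSet T) :
    MeasurableSet {s | ∃ x ∈ points (m (ρ s)), (s, x) ∈ T} := by
  have h : {s | ∃ x ∈ points (m (ρ s)), (s, x) ∈ T} =
      {s | pointKernel (hm.comp hρ) s (Prod.mk s ⁻¹' T) ≠ 0} := by
    ext s
    exact (measure_ne_zero_iff_exists_mem_points (m (ρ s))).symm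
  rw [h]
  exact ((Kernel.measurable_kernel_prodMk_left hT) (measurableSet_singleton 0)).compl

theorem measurableSet_mem_points {S : Type*} [MeasurableSpace S]
    {m : Ω → CountingMeasure X} (hm : Measurable m) {ρ : S → Ω} (hρ : Measurable ρ)
    {r : S → X} (hr : Measurable r) : MeasurableSet {s | r s ∈ points (m (ρ s))} := by
  have h := measurableSet_exists_mem_points hm hρ
    (T := {p : S × X | p.2 = r p.1})
    (measurableSet_eq_fun measurable_snd (hr.comp measurable_fst))
  convert h using 1
  ext s
  simp

variable [MulAction X Ω] [MeasurableSMul₂ X Ω]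

theorem FlowAdapted.lintegral_smul {m : Ω → CountingMeasure X} (hfa : FlowAdapted m) (z : X)
    (ω : Ω) {f : X → ℝ≥0∞} (hf : Measurable f) :
    ∫⁻ x, f x ∂(m (z • ω) : Measure X) = ∫⁻ x, f (z * x) ∂(m ω : Measure X) := by
  rw [hfa z ω, leftTranslate, lintegral_map hf (measurable_const_mul z)]

theorem FlowAdapted.mul_mem_points_smul {m : Ω → CountingMeasure X} (hfa : FlowAdapted m) (z : X)
    (ω : Ω) (x : X) : z * x ∈ points (m (z • ω)) ↔ x ∈ points (m ω) := by
  simp only [points, mem_ofPred_eq]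
  rw [hfa z ω, leftTranslate,
    Measure.map_apply (measurable_const_mul z) (measurableSet_singleton _)]
  have : (fun y => z * y) ⁻¹' {z * x} = {x} := by ext y; simp
  rw [this]

/-- Integration with respect to the Palm measure. -/
theorem lintegral_palm {P : Measure Ω} [SFinite P] {haar : Measure X}
    {m : Ω → CountingMeasure X} (hm : Measurable m) {w : X → ℝ≥0} (hw : Measurable w)
    {F : Ω → ℝ≥0∞} (hF : Measurable F) :
    ∫⁻ ω, F ω ∂(palm P haar m w) = (intensity P haar m)⁻¹ *
      ∫⁻ ω, ∫⁻ x, w x * F (x⁻¹ • ω) ∂(m ω : Measure X) ∂P := by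
  have hW : Measurable fun p : Ω × X => (w p.2 : ℝ≥0∞) := by fun_prop
  have hT : Measurable fun p : Ω × X => p.2⁻¹ • p.1 := by fun_prop
  -- The Palm measure is the weighted Campbell measure on `Ω × X`, pushed forward by the shift that
  -- moves the point to the neutral element.
  set Q : Measure Ω := (intensity P haar m)⁻¹ •
    (((P ⊗ₘ pointKernel hm).withDensity fun p => (w p.2 : ℝ≥0∞)).map fun p => p.2⁻¹ • p.1)
    with hQ
  have key : ∀ F : Ω → ℝ≥0∞, Measurable F → ∫⁻ ω, F ω ∂Q = (intensity P haar m)⁻¹ *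
      ∫⁻ ω, ∫⁻ x, w x * F (x⁻¹ • ω) ∂(m ω : Measure X) ∂P := by
    intro F hF
    have hFT : Measurable fun p : Ω × X => F (p.2⁻¹ • p.1) := hF.comp hT
    rw [hQ, lintegral_smul_measure, smul_eq_mul, lintegral_map hF hT,
      lintegral_withDensity_eq_lintegral_mul _ hW hFT,
      Measure.lintegral_compProd (hW.mul hFT)]
    rfl
  have hpQ : palm P haar m w = Q := by
    ext A hA
    rw [palm_apply hm hw hA, ← lintegral_indicator_one hA, key _ (measurable_one.indicator hA)]
    congr 1
    refine lintegral_congr fun ω => lintegral_congr fun x => ?_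
    by_cases hx : x⁻¹ • ω ∈ A <;> simp [hx]
  rw [hpQ, key F hF]

/-- The mean measure of a stationary point process is its intensity times Haar measure. -/
theorem meanMeasure_eq_intensity_smul {P : Measure Ω} [SMulInvariantMeasure X Ω P]
    {haar : Measure X} [haar.IsHaarMeasure]
    {m : Ω → CountingMeasure X} (hm : Measurable m) (hfa : FlowAdapted m)
    [IsLocallyFiniteMeasure (meanMeasure P m)] :
    meanMeasure P m = intensity P haar m • haar ∧ intensity P haar m ≠ ∞ := by
  have hinv : (meanMeasure P m).IsMulLeftInvariant := by
    refine ⟨fun x => ?_⟩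
    ext B hB
    have hpre : MeasurableSet ((fun y => x * y) ⁻¹' B) := measurable_const_mul x hB
    rw [Measure.map_apply (measurable_const_mul x) hB, meanMeasure_apply hm hpre,
      meanMeasure_apply hm hB]
    have hB' : Measurable fun ω => (m ω : Measure X) B :=
      (Measure.measurable_coe hB).comp (measurable_coe_measure hm)
    rw [← (measurePreserving_smul x P).lintegral_comp hB']
    refine lintegral_congr fun ω => ?_
    rw [hfa x ω, leftTranslate, Measure.map_apply (measurable_const_mul x) hB]
  have h := Measure.isMulLeftInvariant_eq_smul (meanMeasure P m) haar
  set c := Measure.haarScalarFactor (meanMeasure P m) haar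
  have hc : intensity P haar m = c := by
    set K := Classical.arbitrary (TopologicalSpace.PositiveCompacts X)
    have h0 : haar K ≠ 0 :=
      (Measure.measure_pos_of_nonempty_interior haar K.interior_nonempty).ne'
    rw [intensity, h, Measure.smul_apply, ENNReal.smul_def, smul_eq_mul]
    exact ENNReal.mul_div_cancel_right h0 K.isCompact.measure_lt_top.ne
  rw [hc]
  exact ⟨by rw [h]; rfl, ENNReal.coe_ne_top⟩

theorem intensity_ne_zero {P : Measure Ω} [SMulInvariantMeasure X Ω P]
    {haar : Measure X} [haar.IsHaarMeasure]
    {m : Ω → CountingMeasure X} (hm : Measurable m) (hfa : FlowAdapted m)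
    [IsLocallyFiniteMeasure (meanMeasure P m)] (h0 : meanMeasure P m ≠ 0) :
    intensity P haar m ≠ 0 := by
  intro h
  have := (meanMeasure_eq_intensity_smul (P := P) (haar := haar) hm hfa).1
  rw [h, zero_smul] at this
  exact h0 this

/-- Campbell's formula gives total mass `γ⁻¹ * (γ * ∫ w)`, and the intensity `γ` is neither zero nor
infinite. -/
theorem isProbabilityMeasure_palm {P : Measure Ω} [SFinite P] [SMulInvariantMeasure X Ω P]
    {haar : Measure X} [haar.IsHaarMeasure]
    {m : Ω → CountingMeasure X} (hm : Measurable m) (hfa : FlowAdapted m)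
    [IsLocallyFiniteMeasure (meanMeasure P m)] (h0 : meanMeasure P m ≠ 0)
    {w : X → ℝ≥0} (hw : Measurable w) (hw1 : ∫⁻ x, (w x : ℝ≥0∞) ∂haar = 1) :
    IsProbabilityMeasure (palm P haar m w) := by
  obtain ⟨h1, h2⟩ := meanMeasure_eq_intensity_smul (P := P) (haar := haar) hm hfa
  have hw' : Measurable fun x => (w x : ℝ≥0∞) := hw.coe_nnreal_ennreal
  have h3 : ∫⁻ ω, ∫⁻ x, w x ∂(m ω : Measure X) ∂P = ∫⁻ x, w x ∂(meanMeasure P m) :=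
    (Measure.lintegral_bind (measurable_coe_measure hm).aemeasurable hw'.aemeasurable).symm
  refine ⟨?_⟩
  rw [← lintegral_one, lintegral_palm hm hw measurable_const]
  simp only [mul_one]
  rw [h3, h1, lintegral_smul_measure, hw1, smul_eq_mul, mul_one]
  exact ENNReal.inv_mul_cancel (intensity_ne_zero hm hfa h0) h2

/-- An invariant null event is null for the Palm measure. -/
theorem palm_eq_zero_of_invariant {P : Measure Ω} [SFinite P] {haar : Measure X}
    {m : Ω → CountingMeasure X} (hm : Measurable m) {w : X → ℝ≥0} (hw : Measurable w)
    {A : Set Ω} (hA : MeasurableSet A) (hinv : ∀ (x : X) ω, x • ω ∈ A → ω ∈ A) (h0 : P A = 0) :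
    palm P haar m w A = 0 := by
  rw [palm_apply hm hw hA]
  have h : ∀ᵐ ω ∂P, ∫⁻ x, A.indicator (fun _ => (w x : ℝ≥0∞)) (x⁻¹ • ω) ∂(m ω : Measure X) = 0 := by
    have h0' : ∀ᵐ ω ∂P, ω ∉ A := measure_eq_zero_iff_ae_notMem.1 h0
    filter_upwards [h0'] with ω hω
    have : ∀ x : X, A.indicator (fun _ => (w x : ℝ≥0∞)) (x⁻¹ • ω) = 0 :=
      fun x => indicator_of_notMem (fun hx => hω (hinv _ _ hx)) _
    simp [this]
  rw [lintegral_congr_ae h]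
  simp

/-- The Palm measure only sees `ω` shifted by the inverse of one of its own points, and that point
lands at `1`. -/
theorem palm_one_mem_points {P : Measure Ω} [SFinite P] {haar : Measure X}
    {m : Ω → CountingMeasure X} (hm : Measurable m) (hfa : FlowAdapted m) {w : X → ℝ≥0}
    (hw : Measurable w) : ∀ᵐ ω ∂(palm P haar m w), (1 : X) ∈ points (m ω) := by
  have hA : MeasurableSet {ω | (1 : X) ∈ points (m ω)} :=
    measurableSet_mem_points hm measurable_id measurable_const
  rw [ae_iff, ← compl_ofPred, palm_apply hm hw hA.compl]
  have h : ∀ ω, ∫⁻ x, {ω | (1 : X) ∈ points (m ω)}ᶜ.indicator (fun _ => (w x : ℝ≥0∞)) (x⁻¹ • ω)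
      ∂(m ω : Measure X) = 0 := by
    intro ω
    have hae : ∀ᵐ x ∂(m ω : Measure X), x ∈ points (m ω) := measure_compl_points (m ω)
    rw [← lintegral_zero (μ := (m ω : Measure X))]
    refine lintegral_congr_ae ?_
    filter_upwards [hae] with x hx
    have h1 := (hfa.mul_mem_points_smul x⁻¹ ω x).2 hx
    rw [inv_mul_cancel] at h1
    exact indicator_of_notMem (s := {ω | (1 : X) ∈ points (m ω)}ᶜ) (notMem_compl_iff.2 h1) _
  simp [h]

/-- The mass transport principle for functions that are invariant under diagonal shifts. -/
theorem lintegral_swap_weight {P : Measure Ω} [SFinite P] [SMulInvariantMeasure X Ω P]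
    {haar : Measure X} [haar.IsHaarMeasure] [haar.IsMulRightInvariant]
    {m : Ω → CountingMeasure X} (hm : Measurable m) (hfa : FlowAdapted m)
    {w : X → ℝ≥0} (hw : Measurable w) (hw1 : ∫⁻ x, (w x : ℝ≥0∞) ∂haar = 1)
    {K : Ω → X → X → ℝ≥0∞} (hK : Measurable fun p : Ω × X × X => K p.1 p.2.1 p.2.2)
    (hinv : ∀ (z : X) ω x y, K (z • ω) (z * x) (z * y) = K ω x y) :
    ∫⁻ ω, ∫⁻ x, ∫⁻ y, w x * K ω x y ∂(m ω : Measure X) ∂(m ω : Measure X) ∂P =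
      ∫⁻ ω, ∫⁻ x, ∫⁻ y, w y * K ω x y ∂(m ω : Measure X) ∂(m ω : Measure X) ∂P := by
  have hsf : ∀ ω, SFinite (m ω : Measure X) := sFinite_pointProcess hm
  have hii := isInvInvariant_of_isMulRightInvariant haar
  -- The second order Campbell measure: a configuration together with two of its points.
  set M : Measure (Ω × X × X) := P ⊗ₘ (pointKernel hm ×ₖ pointKernel hm) with hM
  have hMint : ∀ f : Ω × X × X → ℝ≥0∞, Measurable f → ∫⁻ p, f p ∂M =
      ∫⁻ ω, ∫⁻ x, ∫⁻ y, f (ω, x, y) ∂(m ω : Measure X) ∂(m ω : Measure X) ∂P := by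
    intro f hf
    rw [hM, Measure.lintegral_compProd hf]
    refine lintegral_congr fun ω => ?_
    rw [Kernel.prod_apply]
    exact lintegral_prod _ (hf.comp measurable_prodMk_left).aemeasurable
  have hw' : Measurable fun x => (w x : ℝ≥0∞) := hw.coe_nnreal_ennreal
  -- Invariance of `P` and flow-adaptedness make `M` invariant under the diagonal shift; since `K`
  -- is invariant too, only the weight `k` gets shifted.
  have hshift : ∀ (k : X → X → ℝ≥0∞), (Measurable fun p : X × X => k p.1 p.2) → ∀ z : X,
      ∫⁻ p, k (z * p.2.1) (z * p.2.2) * K p.1 p.2.1 p.2.2 ∂M =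
        ∫⁻ p, k p.2.1 p.2.2 * K p.1 p.2.1 p.2.2 ∂M := by
    intro k hk z
    have hf : Measurable fun p : Ω × X × X => k p.2.1 p.2.2 * K p.1 p.2.1 p.2.2 :=
      (hk.comp measurable_snd).mul hK
    have hf' : Measurable fun p : Ω × X × X =>
        k (z * p.2.1) (z * p.2.2) * K p.1 p.2.1 p.2.2 := by
      refine Measurable.mul (hk.comp (f := fun p : Ω × X × X => (z * p.2.1, z * p.2.2)) ?_) hK
      fun_prop
    rw [hMint _ hf, hMint _ hf']
    have hg : Measurable fun ω => ∫⁻ x, ∫⁻ y, k x y * K ω x y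
        ∂(m ω : Measure X) ∂(m ω : Measure X) := by
      refine measurable_lintegral_pointProcess hm measurable_id ?_
      refine measurable_lintegral_pointProcess hm (S := Ω × X) measurable_fst ?_
      exact hf.comp (f := fun p : (Ω × X) × X => (p.1.1, p.1.2, p.2)) (by fun_prop)
    rw [← (measurePreserving_smul z P).lintegral_comp hg]
    refine lintegral_congr fun ω => ?_
    have hin : Measurable fun x => ∫⁻ y, k x y * K (z • ω) x y ∂(m (z • ω) : Measure X) := by
      refine Measurable.lintegral_prod_right' (ν := (m (z • ω) : Measure X))
        (f := fun p : X × X => k p.1 p.2 * K (z • ω) p.1 p.2) ?_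
      exact hf.comp (f := fun p : X × X => (z • ω, p.1, p.2)) (by fun_prop)
    rw [hfa.lintegral_smul z ω hin]
    refine lintegral_congr fun x => ?_
    have hin' : Measurable fun y => k (z * x) y * K (z • ω) (z * x) y :=
      hf.comp (f := fun y : X => (z • ω, z * x, y)) (by fun_prop)
    rw [hfa.lintegral_smul z ω hin']
    exact lintegral_congr fun y => by simp only [hinv]
  -- Right invariance is used here, and inversion invariance in addition for `z⁻¹` below. This is
  -- where unimodularity enters.
  have hwx : ∀ y : X, ∫⁻ z, (w (z * y) : ℝ≥0∞) ∂haar = 1 := fun y => by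
    rw [lintegral_mul_right_eq_self (fun x => (w x : ℝ≥0∞)) y, hw1]
  have hwx' : ∀ x : X, ∫⁻ z, (w (z⁻¹ * x) : ℝ≥0∞) ∂haar = 1 := fun x => by
    rw [lintegral_inv_eq_self (μ := haar) (fun z => (w (z * x) : ℝ≥0∞)), hwx]
  have hl : ∫⁻ p, w p.2.1 * K p.1 p.2.1 p.2.2 ∂M =
      ∫⁻ z, ∫⁻ p, w p.2.1 * w (z * p.2.2) * K p.1 p.2.1 p.2.2 ∂M ∂haar := by
    rw [lintegral_lintegral_swap]
    · refine lintegral_congr fun p => ?_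
      rw [lintegral_mul_const _ (by fun_prop), lintegral_const_mul _ (by fun_prop), hwx, mul_one]
    · refine Measurable.aemeasurable (Measurable.mul ?_ (hK.comp measurable_snd))
      fun_prop
  have hr : ∫⁻ p, w p.2.2 * K p.1 p.2.1 p.2.2 ∂M =
      ∫⁻ z, ∫⁻ p, w (z⁻¹ * p.2.1) * w p.2.2 * K p.1 p.2.1 p.2.2 ∂M ∂haar := by
    rw [lintegral_lintegral_swap]
    · refine lintegral_congr fun p => ?_
      rw [lintegral_mul_const _ (by fun_prop), lintegral_mul_const _ (by fun_prop), hwx', one_mul]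
    · refine Measurable.aemeasurable (Measurable.mul ?_ (hK.comp measurable_snd))
      fun_prop
  -- For fixed `z`, the diagonal shift by `z` carries the weight `w (z⁻¹ * x) * w y` to `w x * w (z
  -- * y)`, so the two expanded integrals agree already before integration over `z`.
  have hfin : ∫⁻ p, w p.2.1 * K p.1 p.2.1 p.2.2 ∂M = ∫⁻ p, w p.2.2 * K p.1 p.2.1 p.2.2 ∂M := by
    rw [hl, hr]
    refine lintegral_congr fun z => ?_
    rw [← hshift (fun x y => w (z⁻¹ * x) * w y) (by fun_prop) z]
    simp only [inv_mul_cancel_left]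
  have hl' : Measurable fun p : Ω × X × X => w p.2.1 * K p.1 p.2.1 p.2.2 :=
    Measurable.mul (by fun_prop) hK
  have hr' : Measurable fun p : Ω × X × X => w p.2.2 * K p.1 p.2.1 p.2.2 :=
    Measurable.mul (by fun_prop) hK
  rwa [hMint _ hl', hMint _ hr'] at hfin

/-- The exchange formula for the Palm measure of a point process on a unimodular group. -/
theorem palm_exchange {P : Measure Ω} [SFinite P] [SMulInvariantMeasure X Ω P]
    {haar : Measure X} [haar.IsHaarMeasure] [haar.IsMulRightInvariant]
    {m : Ω → CountingMeasure X} (hm : Measurable m) (hfa : FlowAdapted m)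
    {w : X → ℝ≥0} (hw : Measurable w) (hw1 : ∫⁻ x, (w x : ℝ≥0∞) ∂haar = 1)
    {f : Ω → X → ℝ≥0∞} (hf : Measurable (Function.uncurry f)) :
    ∫⁻ ω, ∫⁻ v, f ω v ∂(m ω : Measure X) ∂(palm P haar m w) =
      ∫⁻ ω, ∫⁻ v, f (v⁻¹ • ω) v⁻¹ ∂(m ω : Measure X) ∂(palm P haar m w) := by
  have hsf : ∀ ω, SFinite (m ω : Measure X) := sFinite_pointProcess hm
  have hf' : Measurable (Function.uncurry fun (ω : Ω) (v : X) => f (v⁻¹ • ω) v⁻¹) :=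
    hf.comp (f := fun p : Ω × X => (p.2⁻¹ • p.1, p.2⁻¹)) (by fun_prop)
  have hF : Measurable fun ω => ∫⁻ v, f ω v ∂(m ω : Measure X) :=
    measurable_lintegral_pointProcess hm measurable_id hf
  have hF' : Measurable fun ω => ∫⁻ v, f (v⁻¹ • ω) v⁻¹ ∂(m ω : Measure X) :=
    measurable_lintegral_pointProcess hm measurable_id hf'
  rw [lintegral_palm hm hw hF, lintegral_palm hm hw hF']
  congr 1
  have hK : Measurable fun p : Ω × X × X => f (p.2.1⁻¹ • p.1) (p.2.1⁻¹ * p.2.2) :=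
    hf.comp (f := fun p : Ω × X × X => (p.2.1⁻¹ • p.1, p.2.1⁻¹ * p.2.2)) (by fun_prop)
  -- The kernel `f (x⁻¹ • ω) (x⁻¹ * y)` views the pair from `x`, hence is invariant under diagonal
  -- shifts. The two Palm integrals differ only in whether `w` weighs `x` or `y`.
  have h := lintegral_swap_weight (P := P) hm hfa hw hw1
    (K := fun ω x y => f (x⁻¹ • ω) (x⁻¹ * y)) hK (by
      intro z ω x y
      simp only [mul_inv_rev, mul_smul, inv_smul_smul, mul_assoc, inv_mul_cancel_left])
  have hl : ∀ ω, ∫⁻ x, w x * ∫⁻ v, f (x⁻¹ • ω) v ∂(m (x⁻¹ • ω) : Measure X) ∂(m ω : Measure X) =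
      ∫⁻ x, ∫⁻ y, w x * f (x⁻¹ • ω) (x⁻¹ * y) ∂(m ω : Measure X) ∂(m ω : Measure X) := by
    intro ω
    refine lintegral_congr fun x => ?_
    have h1 : Measurable fun v => f (x⁻¹ • ω) v := hf.comp measurable_prodMk_left
    rw [hfa.lintegral_smul _ _ h1, lintegral_const_mul _ (by fun_prop)]
  have hr : ∀ ω, ∫⁻ x, w x * ∫⁻ v, f (v⁻¹ • x⁻¹ • ω) v⁻¹ ∂(m (x⁻¹ • ω) : Measure X)
      ∂(m ω : Measure X) =
      ∫⁻ x, ∫⁻ y, w y * f (x⁻¹ • ω) (x⁻¹ * y) ∂(m ω : Measure X) ∂(m ω : Measure X) := by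
    intro ω
    rw [lintegral_lintegral_swap (f := fun x y => (w y : ℝ≥0∞) * f (x⁻¹ • ω) (x⁻¹ * y))]
    · refine lintegral_congr fun x => ?_
      have h1 : Measurable fun v : X => f (v⁻¹ • x⁻¹ • ω) v⁻¹ :=
        hf.comp (f := fun v : X => (v⁻¹ • x⁻¹ • ω, v⁻¹)) (by fun_prop)
      rw [hfa.lintegral_smul _ _ h1, ← lintegral_const_mul _ (by fun_prop)]
      refine lintegral_congr fun y => ?_
      simp only [mul_inv_rev, inv_inv, mul_smul, smul_inv_smul]
    · refine Measurable.aemeasurable (Measurable.mul (by fun_prop) ?_)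
      exact hf.comp (f := fun p : X × X => (p.1⁻¹ • ω, p.1⁻¹ * p.2)) (by fun_prop)
  simp only [hl, hr]
  exact h

end Palm

/-! ### Distances and balls in graphs -/

section Graph

variable {V W : Type*} {G : SimpleGraph V} {H : SimpleGraph W} {s : Set V} {t : Set W}

/-- A geodesic from `a` to `b` stays within distance `n` of `a`, hence inside `s`, and can be
transported by `φ`. Applied to `φ` and `φ.symm`, this shows that isomorphisms of large balls
preserve smaller balls. -/
theorem dist_le_of_induce_iso (hG : G.Connected) (φ : G.induce s ≃g H.induce t) {n : ℕ} {a b : V}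
    (ha : a ∈ s) (hb : b ∈ s) (hs : ∀ x, G.dist a x ≤ n → x ∈ s) (hab : G.dist a b ≤ n) :
    H.dist (φ ⟨a, ha⟩ : W) (φ ⟨b, hb⟩) ≤ G.dist a b := by
  classical
  obtain ⟨p, hp⟩ := hG.exists_walk_length_eq_dist a b
  have hsup : ∀ x ∈ p.support, x ∈ s := fun x hx => by
    refine hs x (((SimpleGraph.dist_le (p.takeUntil x hx)).trans ?_).trans hab)
    rw [← hp]
    exact p.length_takeUntil_le_length hx
  have hlen : (p.induce s hsup).length = p.length := by
    refine (SimpleGraph.Walk.length_map (SimpleGraph.Embedding.induce s).toHom _).symm.trans ?_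
    exact congrArg SimpleGraph.Walk.length (SimpleGraph.Walk.map_induce p hsup)
  let q := ((p.induce s hsup).map φ.toHom).map (SimpleGraph.Embedding.induce t).toHom
  have hq : q.length = G.dist a b := by
    simp only [q, SimpleGraph.Walk.length_map, hlen, hp]
  rw [← hq]
  exact SimpleGraph.dist_le q

theorem finite_setOf_dist_le (hG : G.Connected) (hf : ∀ v, (G.neighborSet v).Finite) (o : V)
    (n : ℕ) : {v | G.dist o v ≤ n}.Finite := by
  induction n with
  | zero =>
    refine (finite_singleton o).subset fun v hv => ?_
    exact (hG.dist_eq_zero_iff.1 (Nat.le_zero.1 hv)).symm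
  | succ n ih =>
    refine (ih.union (ih.biUnion fun v _ => hf v)).subset fun v hv => ?_
    obtain ⟨p, hp⟩ := hG.exists_walk_length_eq_dist v o
    cases p with
    | nil => exact Or.inl (by simp)
    | cons h q =>
      refine Or.inr (mem_biUnion (x := _) ?_ h.symm)
      have h1 := SimpleGraph.dist_le q.reverse
      have h2 : G.dist o v ≤ n + 1 := hv
      rw [SimpleGraph.dist_comm, ← hp, SimpleGraph.Walk.length_cons] at h2
      rw [SimpleGraph.Walk.length_reverse] at h1
      exact h1.trans (by omega)

end Graph

/-! ### The local topology and the counting kernel over vertices -/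

section Network

variable {Ξ : Type u} [MetricSpace Ξ] {k l : ℕ}

theorem PointedNetwork.root_mem_ball (A : PointedNetwork Ξ k) (r : ℝ) (i : Fin k) :
    A.root i ∈ A.ball r := ⟨i, by simp⟩

/-- An approximate isomorphism between large vertex sets restricts to balls inside them. -/
theorem close_of_induce_iso {A B : Network Ξ} {s : Set A.V} {t : Set B.V}
    (φ : A.graph.induce s ≃g B.graph.induce t) {ε r : ℝ} (hε : ε ≤ 1 / r)
    (hv : ∀ v : s, dist (A.vertexMark v) (B.vertexMark (φ v)) ≤ ε)
    (he : ∀ v w : s, A.graph.Adj v w → dist (A.edgeMark v w) (B.edgeMark (φ v) (φ w)) ≤ ε)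
    (ρ : Fin l → A.V) (σ : Fin l → B.V) (hρ : ∀ i, ρ i ∈ s)
    (hσ : ∀ i, (φ ⟨ρ i, hρ i⟩ : B.V) = σ i)
    (hs : ∀ i x, A.graph.dist (ρ i) x ≤ ⌈r⌉₊ → x ∈ s)
    (ht : ∀ i x, B.graph.dist (σ i) x ≤ ⌈r⌉₊ → x ∈ t) :
    (PointedNetwork.mk A ρ).Close r (PointedNetwork.mk B σ) := by
  have hσt : ∀ i, σ i ∈ t := fun i => hσ i ▸ (φ ⟨ρ i, hρ i⟩).2
  have hρ' : ∀ i, (φ.symm ⟨σ i, hσt i⟩ : A.V) = ρ i := by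
    intro i
    have : φ ⟨ρ i, hρ i⟩ = ⟨σ i, hσt i⟩ := Subtype.ext (hσ i)
    rw [← this, RelIso.symm_apply_apply]
  have hsub : ∀ v ∈ (PointedNetwork.mk A ρ).ball r, v ∈ s := fun v ⟨i, hi⟩ => hs i v hi
  have hsub' : ∀ v ∈ (PointedNetwork.mk B σ).ball r, v ∈ t := fun v ⟨i, hi⟩ => ht i v hi
  -- Neither `φ` nor its inverse increases distances from the roots, so balls are mapped into balls
  -- in both directions.
  have hto : ∀ (v : A.V) (hv : v ∈ (PointedNetwork.mk A ρ).ball r),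
      (φ ⟨v, hsub v hv⟩ : B.V) ∈ (PointedNetwork.mk B σ).ball r := by
    rintro v ⟨i, hi⟩
    refine ⟨i, ?_⟩
    have := dist_le_of_induce_iso A.connected φ (hρ i) (hs i v hi) (hs i) hi
    rw [hσ i] at this
    exact this.trans hi
  have hinv : ∀ (v : B.V) (hv : v ∈ (PointedNetwork.mk B σ).ball r),
      (φ.symm ⟨v, hsub' v hv⟩ : A.V) ∈ (PointedNetwork.mk A ρ).ball r := by
    rintro v ⟨i, hi⟩
    refine ⟨i, ?_⟩
    have := dist_le_of_induce_iso B.connected φ.symm (hσt i) (ht i v hi) (ht i) hi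
    rw [hρ' i] at this
    exact this.trans hi
  refine ⟨⟨⟨fun v => ⟨φ ⟨v, hsub v v.2⟩, hto v v.2⟩,
    fun v => ⟨φ.symm ⟨v, hsub' v v.2⟩, hinv v v.2⟩, fun v => ?_, fun v => ?_⟩, ?_⟩, ?_, ?_, ?_⟩
  · exact Subtype.ext (by simp)
  · exact Subtype.ext (by simp)
  · intro v w
    exact φ.map_rel_iff (a := ⟨v, hsub v v.2⟩) (b := ⟨w, hsub w w.2⟩)
  · rintro i ⟨v, hv⟩ rfl
    exact hσ i
  · exact fun v => (hv ⟨v, hsub v v.2⟩).trans hε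
  · exact fun v w h => (he ⟨v, hsub v v.2⟩ ⟨w, hsub w w.2⟩ h).trans hε

/-- The map `[G, o, v] ↦ [G, o]`. -/
def forget : NetworkClass Ξ 2 → NetworkClass Ξ 1 :=
  Quotient.map (fun A : PointedNetwork Ξ 2 => PointedNetwork.mk A.toNetwork ![A.root 0]) (by
    rintro A B ⟨φ, h1, h2, h3⟩
    refine ⟨φ, h1, h2, fun i => ?_⟩
    fin_cases i
    exact h3 0)

theorem forget_birooted (G : Network Ξ) (o v : G.V) : forget (birooted G o v) = rooted G o := rfl

/-- The ball around one root lies in the ball around both, so a close approximation of the birooted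
network restricts to one of the rooted network at the same radius. -/
theorem continuous_forget : Continuous (forget : NetworkClass Ξ 2 → NetworkClass Ξ 1) := by
  refine continuous_def.2 fun U hU => ?_
  intro A hA
  obtain ⟨R, hR, h⟩ := hU _ hA
  refine ⟨R, hR, fun r hr B ⟨φ, h1, h2, h3⟩ => h r hr _ ?_⟩
  refine close_of_induce_iso φ le_rfl h2 h3 _ _ (fun i => ?_) (fun i => ?_) (fun i x hx => ?_)
    (fun i x hx => ?_)
  all_goals fin_cases i
  · exact A.root_mem_ball r 0
  · exact h1 0 _ rfl
  · exact ⟨0, hx⟩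
  · exact ⟨0, hx⟩

theorem exists_eq_rooted (a : NetworkClass Ξ 1) : ∃ (G : Network Ξ) (o : G.V), a = rooted G o := by
  induction a using Quotient.inductionOn with
  | h A =>
    refine ⟨A.toNetwork, A.root 0, congrArg _ ?_⟩
    obtain ⟨G, ρ⟩ := A
    congr 1
    ext i
    fin_cases i
    rfl

theorem exists_eq_birooted (a : NetworkClass Ξ 2) :
    ∃ (G : Network Ξ) (o v : G.V), a = birooted G o v := by
  induction a using Quotient.inductionOn with
  | h A =>
    refine ⟨A.toNetwork, A.root 0, A.root 1, congrArg _ ?_⟩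
    obtain ⟨G, ρ⟩ := A
    congr 1
    ext i
    fin_cases i <;> rfl

theorem mk_eq_rooted (A : PointedNetwork Ξ 1) :
    (Quotient.mk _ A : NetworkClass Ξ 1) = rooted A.toNetwork (A.root 0) := by
  refine congrArg _ ?_
  obtain ⟨G, ρ⟩ := A
  congr 1
  ext i
  fin_cases i
  rfl

/-- The distance of the two distinguished vertices. -/
noncomputable def rootDist : NetworkClass Ξ 2 → ℕ :=
  Quotient.lift (fun A : PointedNetwork Ξ 2 => A.graph.dist (A.root 0) (A.root 1)) (by
    rintro A B ⟨φ, -, -, h3⟩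
    rw [← h3 0, ← h3 1]
    refine le_antisymm ?_ ?_
    · obtain ⟨p, hp⟩ := B.connected.exists_walk_length_eq_dist (φ (A.root 0)) (φ (A.root 1))
      have h := SimpleGraph.dist_le (p.map φ.symm.toHom)
      simp only [SimpleGraph.Walk.length_map, hp] at h
      simpa using h
    · obtain ⟨p, hp⟩ := A.connected.exists_walk_length_eq_dist (A.root 0) (A.root 1)
      have h := SimpleGraph.dist_le (p.map φ.toHom)
      rw [SimpleGraph.Walk.length_map, hp] at h
      exact h)

theorem rootDist_birooted (G : Network Ξ) (o v : G.V) :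
    rootDist (birooted G o v) = G.graph.dist o v := rfl

theorem isOpen_rootDist_le (n : ℕ) : IsOpen {b : NetworkClass Ξ 2 | rootDist b ≤ n} := by
  intro A hA
  refine ⟨n + 1, by positivity, fun r hr B ⟨φ, h1, h2, h3⟩ => ?_⟩
  have hA' : A.graph.dist (A.root 0) (A.root 1) ≤ n := hA
  change B.graph.dist (B.root 0) (B.root 1) ≤ n
  have hnr : n ≤ ⌈r⌉₊ := by
    have : (n : ℝ) ≤ ⌈r⌉₊ := by linarith [Nat.le_ceil r]
    exact_mod_cast this
  have := dist_le_of_induce_iso A.connected φ (A.root_mem_ball r 0) (A.root_mem_ball r 1)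
    (fun x hx => ⟨0, hx⟩) (hA'.trans hnr)
  rw [h1 0 _ rfl, h1 1 _ rfl] at this
  exact this.trans hA'

theorem massOut_rooted (g : NetworkClass Ξ 2 → ℝ≥0∞) (G : Network Ξ) (o : G.V) :
    massOut g (rooted G o) = ∑' v, g (birooted G o v) := rfl

theorem massIn_rooted (g : NetworkClass Ξ 2 → ℝ≥0∞) (G : Network Ξ) (o : G.V) :
    massIn g (rooted G o) = ∑' v, g (birooted G v o) := rfl

/-- If `[G, o, v]` lies in an open set, then so does its image under a close approximation of
`[G, o]`. -/
theorem exists_birooted_mem {U : Set (NetworkClass Ξ 2)} (hU : IsOpen U) {G : Network Ξ}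
    {o v : G.V} (h : birooted G o v ∈ U) :
    ∃ R : ℝ, 0 < R ∧ ∀ r > R, ∀ (H : Network Ξ) (p : H.V)
      (φ : G.graph.induce ((PointedNetwork.mk G ![o]).ball r) ≃g
        H.graph.induce ((PointedNetwork.mk H ![p]).ball r))
      (hv : v ∈ (PointedNetwork.mk G ![o]).ball r),
      (∀ x : (PointedNetwork.mk G ![o]).ball r, (x : G.V) = o → (φ x : H.V) = p) →
      (∀ x : (PointedNetwork.mk G ![o]).ball r,
        dist (G.vertexMark x) (H.vertexMark (φ x)) ≤ 1 / r) →
      (∀ x y : (PointedNetwork.mk G ![o]).ball r, G.graph.Adj x y →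
        dist (G.edgeMark x y) (H.edgeMark (φ x) (φ y)) ≤ 1 / r) →
      birooted H p (φ ⟨v, hv⟩) ∈ U := by
  obtain ⟨R, hR, hRU⟩ := hU _ h
  set d := G.graph.dist o v with hd
  -- The balls of radius `r - d` around both `o` and `v` lie inside the ball of radius `r` around
  -- `o`. As `d` is an integer, rounding up commutes with the subtraction.
  refine ⟨R + d, by positivity, fun r hr H p φ hv h1 h2 h3 => hRU (r - d) ?_ _ ?_⟩
  · linarith
  have hceil : ⌈r - d⌉₊ + d = ⌈r⌉₊ := by
    rw [Nat.ceil_sub_natCast]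
    refine Nat.sub_add_cancel ?_
    have : (d : ℝ) ≤ ⌈r⌉₊ := by linarith [Nat.le_ceil r]
    exact_mod_cast this
  have ho : o ∈ (PointedNetwork.mk G ![o]).ball r := PointedNetwork.root_mem_ball _ r 0
  have hd' : H.graph.dist p (φ ⟨v, hv⟩) ≤ d := by
    have := dist_le_of_induce_iso G.connected φ ho hv (n := ⌈r⌉₊) (fun x hx => ⟨0, hx⟩) (by omega)
    rwa [h1 ⟨o, ho⟩ rfl] at this
  have hd0 : (0 : ℝ) ≤ d := by positivity
  refine close_of_induce_iso φ (one_div_le_one_div_of_le (by linarith) (by linarith)) h2 h3 _ _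
    (fun i => ?_) (fun i => ?_) (fun i x hx => ⟨0, ?_⟩) (fun i x hx => ⟨0, ?_⟩)
  · fin_cases i
    exacts [ho, hv]
  · fin_cases i
    exacts [h1 ⟨o, ho⟩ rfl, rfl]
  · change G.graph.dist o x ≤ _
    fin_cases i
    · replace hx : G.graph.dist o x ≤ _ := hx
      omega
    · replace hx : G.graph.dist v x ≤ _ := hx
      have := G.connected.dist_triangle (u := o) (v := v) (w := x)
      omega
  · change H.graph.dist p x ≤ _
    fin_cases i
    · replace hx : H.graph.dist p x ≤ _ := hx
      omega
    · replace hx : H.graph.dist (φ ⟨v, hv⟩ : H.V) x ≤ _ := hx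
      have := H.connected.dist_triangle (u := p) (v := φ ⟨v, hv⟩) (w := x)
      omega

/-- Lower semicontinuity of the number of vertices `v` with `[G, o, v] ∈ U`: finitely many vertices
already exceed `c`, each persists in close networks, and injectivity of the approximate isomorphism
keeps their images distinct. -/
theorem isOpen_lt_massOut_indicator {U : Set (NetworkClass Ξ 2)} (hU : IsOpen U) (c : ℝ≥0∞) :
    IsOpen {a : NetworkClass Ξ 1 | c < massOut (U.indicator 1) a} := by
  classical
  intro A hA
  obtain ⟨G, ρ⟩ := A
  obtain ⟨o, rfl⟩ : ∃ o, ρ = ![o] := ⟨ρ 0, by ext i; fin_cases i; rfl⟩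
  have hA' : c < ∑' v : G.V, U.indicator (1 : NetworkClass Ξ 2 → ℝ≥0∞) (birooted G o v) := hA
  rw [ENNReal.tsum_eq_iSup_sum, lt_iSup_iff] at hA'
  obtain ⟨F, hF⟩ := hA'
  -- `R v` is arbitrary when `[G, o, v] ∉ U`; the absolute values in `S` make `S` an upper bound all
  -- the same.
  choose! R hR hRU using fun (v : G.V) (hv : birooted G o v ∈ U) => exists_birooted_mem hU hv
  set S : ℝ := 1 + ∑ v ∈ F, (|R v| + G.graph.dist o v) with hS
  have hle : ∀ v ∈ F, |R v| + G.graph.dist o v ≤ S - 1 := by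
    intro v hv
    rw [hS, add_sub_cancel_left]
    exact Finset.single_le_sum (f := fun v => |R v| + (G.graph.dist o v : ℝ))
      (fun v _ => by positivity) hv
  have hS0 : 0 < S := by positivity
  refine ⟨S, hS0, fun r hr B hB => ?_⟩
  obtain ⟨H, σ⟩ := B
  obtain ⟨p, rfl⟩ : ∃ o, σ = ![o] := ⟨σ 0, by ext i; fin_cases i; rfl⟩
  obtain ⟨φ, h1, h2, h3⟩ := hB
  change c < ∑' v : H.V, U.indicator (1 : NetworkClass Ξ 2 → ℝ≥0∞) (birooted H p v)
  have hball : ∀ v ∈ F, v ∈ (PointedNetwork.mk G ![o]).ball r := by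
    intro v hv
    refine ⟨0, ?_⟩
    change G.graph.dist o v ≤ _
    have : (G.graph.dist o v : ℝ) ≤ ⌈r⌉₊ := by
      linarith [Nat.le_ceil r, hle v hv, abs_nonneg (R v)]
    exact_mod_cast this
  refine hF.trans_le ?_
  rw [← Finset.sum_coe_sort, ← tsum_fintype (L := .unconditional F)]
  refine le_trans ?_ (ENNReal.tsum_comp_le_tsum_of_injective
    (f := fun v : F => (φ ⟨v, hball v v.2⟩ : H.V)) ?_ _)
  · refine ENNReal.tsum_le_tsum fun v => ?_
    by_cases hv : birooted G o v ∈ U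
    · have : birooted H p (φ ⟨v, hball v v.2⟩) ∈ U := by
        refine hRU v hv r ?_ H p φ (hball v v.2) (h1 0) h2 h3
        have hd0 : (0 : ℝ) ≤ G.graph.dist o v := by positivity
        linarith [hle v v.2, le_abs_self (R v)]
      simp [hv, this]
    · simp [hv]
  · intro v w hvw
    have := φ.injective (Subtype.ext hvw)
    exact Subtype.ext (congrArg (fun x : (PointedNetwork.mk G ![o]).ball r => (x : G.V)) this)

/-- The sum of the Dirac measures at `[G, o, v]`, `v` a vertex of `G`. -/
noncomputable def vertexMeasure (a : NetworkClass Ξ 1) : Measure (NetworkClass Ξ 2) :=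
  Measure.sum fun v : (Quotient.out a).V =>
    Measure.dirac (birooted (Quotient.out a).toNetwork ((Quotient.out a).root 0) v)

theorem lintegral_vertexMeasure {g : NetworkClass Ξ 2 → ℝ≥0∞} (hg : Measurable g)
    (a : NetworkClass Ξ 1) : ∫⁻ b, g b ∂(vertexMeasure a) = massOut g a := by
  conv_rhs => rw [← Quotient.out_eq a]
  rw [vertexMeasure, lintegral_sum_measure]
  exact tsum_congr fun v => lintegral_dirac' _ hg

theorem vertexMeasure_apply {U : Set (NetworkClass Ξ 2)} (hU : MeasurableSet U)
    (a : NetworkClass Ξ 1) : vertexMeasure a U = massOut (U.indicator 1) a := by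
  rw [← lintegral_vertexMeasure (measurable_one.indicator hU), lintegral_indicator_one hU]

instance : BorelSpace (NetworkClass Ξ k) := ⟨rfl⟩

/-- On open sets the mass is lower semicontinuous. Passing to all Borel sets by the π-system
argument needs finite measures; truncation at `rootDist ≤ n`, an open condition, achieves this
because balls are finite. The truncations increase to the full measure. -/
theorem measurable_vertexMeasure :
    Measurable (vertexMeasure : NetworkClass Ξ 1 → Measure (NetworkClass Ξ 2)) := by
  have hD : ∀ n : ℕ, IsOpen {b : NetworkClass Ξ 2 | rootDist b ≤ n} := isOpen_rootDist_le
  have hopen : ∀ U : Set (NetworkClass Ξ 2), IsOpen U → Measurable fun a => vertexMeasure a U := by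
    intro U hU
    simp only [vertexMeasure_apply hU.measurableSet]
    refine measurable_of_Ioi fun c => ?_
    exact (isOpen_lt_massOut_indicator hU c).measurableSet
  have hfin : ∀ n a, IsFiniteMeasure
      ((vertexMeasure a).restrict {b : NetworkClass Ξ 2 | rootDist b ≤ n}) := by
    intro n a
    refine ⟨?_⟩
    rw [Measure.restrict_apply_univ, vertexMeasure_apply (hD n).measurableSet]
    obtain ⟨G, o, rfl⟩ := exists_eq_rooted a
    rw [massOut_rooted]
    have : (fun v => {b : NetworkClass Ξ 2 | rootDist b ≤ n}.indicator
        (1 : NetworkClass Ξ 2 → ℝ≥0∞) (birooted G o v)) =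
        {v | G.graph.dist o v ≤ n}.indicator (fun _ => (1 : ℝ≥0∞)) := by
      ext v
      by_cases h : G.graph.dist o v ≤ n <;> simp [indicator, rootDist_birooted, h]
    rw [this, ← tsum_subtype, ENNReal.tsum_set_one]
    have h := (finite_setOf_dist_le G.connected G.locallyFinite o n).encard_lt_top
    rw [← ENat.toENNReal_top]
    exact ENat.toENNReal_lt.2 h
  have hres : ∀ n : ℕ, Measurable fun a =>
      (vertexMeasure a).restrict {b : NetworkClass Ξ 2 | rootDist b ≤ n} := by
    intro n
    refine Measurable.measure_of_isPiSystem (S := {U | IsOpen U}) rfl isPiSystem_isOpen ?_ ?_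
    · intro U hU
      have : IsOpen U := hU
      simp only [Measure.restrict_apply this.measurableSet]
      exact hopen _ (this.inter (hD n))
    · simp only [Measure.restrict_apply_univ]
      exact hopen _ (hD n)
  refine Measure.measurable_of_measurable_coe _ fun U hU => ?_
  have hsup : ∀ a : NetworkClass Ξ 1, vertexMeasure a U =
      ⨆ n : ℕ, (vertexMeasure a).restrict {b : NetworkClass Ξ 2 | rootDist b ≤ n} U := by
    intro a
    have hmono : Monotone fun n : ℕ => U ∩ {b : NetworkClass Ξ 2 | rootDist b ≤ n} :=
      fun i j hij => inter_subset_inter_right _ fun b hb => le_trans hb hij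
    simp only [Measure.restrict_apply hU]
    rw [← hmono.measure_iUnion, ← inter_iUnion]
    congr 1
    refine (inter_eq_left.2 fun b _ => ?_).symm
    exact mem_iUnion.2 ⟨rootDist b, le_refl (rootDist b)⟩
  simp only [hsup]
  exact Measurable.iSup fun n => (Measure.measurable_coe hU).comp (hres n)

end Network

/-! ### Isomorphic representatives of a class -/

section Isomorphism

variable {Ξ : Type u}

theorem exists_iso_of_rooted_eq {G H : Network Ξ} {o : G.V} {p : H.V}
    (h : rooted G o = rooted H p) : ∃ φ : G.graph ≃g H.graph,
      (∀ v, G.vertexMark v = H.vertexMark (φ v)) ∧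
      (∀ v w, G.graph.Adj v w → G.edgeMark v w = H.edgeMark (φ v) (φ w)) ∧ φ o = p := by
  obtain ⟨φ, h1, h2, h3⟩ := Quotient.exact h
  exact ⟨φ, h1, h2, h3 0⟩

theorem birooted_eq_of_iso {G H : Network Ξ} (φ : G.graph ≃g H.graph)
    (h1 : ∀ v, G.vertexMark v = H.vertexMark (φ v))
    (h2 : ∀ v w, G.graph.Adj v w → G.edgeMark v w = H.edgeMark (φ v) (φ w)) (v w : G.V) :
    birooted G v w = birooted H (φ v) (φ w) :=
  birooted_eq (A := PointedNetwork.mk G ![v]) (B := PointedNetwork.mk H ![φ v]) φ h1 h2 v w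

end Isomorphism

/-! ### Products of edge marks along walks -/

section Transport

variable {X : Type*} [Group X] {Ξ : Type u} (c : Ξ → X)

/-- The product of the (decoded) edge marks along a walk. -/
def Network.walkProd (G : Network Ξ) : ∀ {u v : G.V}, G.graph.Walk u v → X
  | _, _, .nil => 1
  | u, _, .cons (v := w) _ p => c (G.edgeMark u w) * G.walkProd p

theorem Network.walkProd_append (G : Network Ξ) {u v w : G.V} (p : G.graph.Walk u v)
    (q : G.graph.Walk v w) :
    G.walkProd c (p.append q) = G.walkProd c p * G.walkProd c q := by
  induction p with
  | nil => simp [Network.walkProd]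
  | cons h p ih => simp [Network.walkProd, ih, mul_assoc]

theorem Network.walkProd_map {G H : Network Ξ} (φ : G.graph ≃g H.graph)
    (h2 : ∀ v w, G.graph.Adj v w → G.edgeMark v w = H.edgeMark (φ v) (φ w)) {u v : G.V}
    (p : G.graph.Walk u v) : H.walkProd c (p.map φ.toHom) = G.walkProd c p := by
  induction p with
  | nil => rfl
  | cons h p ih =>
    rw [SimpleGraph.Walk.map_cons]
    change c (H.edgeMark (φ _) (φ _)) * _ = c _ * _
    rw [ih, h2 _ _ h]

/-- The product of the marks along a walk depends only on the end points. -/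
def Network.Consistent (G : Network Ξ) : Prop :=
  ∀ (u v : G.V) (p q : G.graph.Walk u v), G.walkProd c p = G.walkProd c q

open Classical in
/-- The product of the marks along any walk from `o` to `v`, in a consistent network. -/
noncomputable def Network.transport (G : Network Ξ) (o v : G.V) : X :=
  if G.Consistent c then G.walkProd c (G.connected.preconnected o v).some else 1

variable {c}

theorem Network.Consistent.transport_eq {G : Network Ξ} (hG : G.Consistent c) {o v : G.V}
    (p : G.graph.Walk o v) : G.transport c o v = G.walkProd c p := by
  rw [Network.transport, if_pos hG]
  exact hG _ _ _ _

theorem Network.Consistent.transport_mul {G : Network Ξ} (hG : G.Consistent c) (o v w : G.V) :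
    G.transport c o v * G.transport c v w = G.transport c o w := by
  obtain ⟨p⟩ := G.connected.preconnected o v
  obtain ⟨q⟩ := G.connected.preconnected v w
  rw [hG.transport_eq p, hG.transport_eq q, hG.transport_eq (p.append q), G.walkProd_append c]

theorem Network.Consistent.transport_self {G : Network Ξ} (hG : G.Consistent c) (o : G.V) :
    G.transport c o o = 1 := hG.transport_eq .nil

theorem Network.Consistent.transport_symm {G : Network Ξ} (hG : G.Consistent c) (o v : G.V) :
    G.transport c v o = (G.transport c o v)⁻¹ := by
  refine eq_inv_of_mul_eq_one_left ?_
  rw [hG.transport_mul, hG.transport_self]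

theorem Network.Consistent.of_iso {G H : Network Ξ} (hH : H.Consistent c) (φ : G.graph ≃g H.graph)
    (h2 : ∀ v w, G.graph.Adj v w → G.edgeMark v w = H.edgeMark (φ v) (φ w)) :
    G.Consistent c := by
  intro u v p q
  rw [← Network.walkProd_map c φ h2 p, ← Network.walkProd_map c φ h2 q]
  exact hH _ _ _ _

theorem edgeMark_symm_iso {G H : Network Ξ} (φ : G.graph ≃g H.graph)
    (h2 : ∀ v w, G.graph.Adj v w → G.edgeMark v w = H.edgeMark (φ v) (φ w)) (v w : H.V)
    (h : H.graph.Adj v w) : H.edgeMark v w = G.edgeMark (φ.symm v) (φ.symm w) := by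
  rw [h2 _ _ (φ.symm.map_rel_iff.2 h), RelIso.apply_symm_apply, RelIso.apply_symm_apply]

theorem Network.consistent_iff_of_iso {G H : Network Ξ} (φ : G.graph ≃g H.graph)
    (h2 : ∀ v w, G.graph.Adj v w → G.edgeMark v w = H.edgeMark (φ v) (φ w)) :
    G.Consistent c ↔ H.Consistent c :=
  ⟨fun h => h.of_iso φ.symm (edgeMark_symm_iso φ h2), fun h => h.of_iso φ h2⟩

theorem Network.transport_eq_of_iso {G H : Network Ξ} (φ : G.graph ≃g H.graph)
    (h2 : ∀ v w, G.graph.Adj v w → G.edgeMark v w = H.edgeMark (φ v) (φ w)) (o v : G.V) :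
    G.transport c o v = H.transport c (φ o) (φ v) := by
  by_cases hG : G.Consistent c
  · obtain ⟨p⟩ := G.connected.preconnected o v
    rw [hG.transport_eq p, ← Network.walkProd_map c φ h2 p]
    exact (((Network.consistent_iff_of_iso φ h2).1 hG).transport_eq (p.map φ.toHom)).symm
  · rw [Network.transport, if_neg hG, Network.transport,
      if_neg (fun h => hG ((Network.consistent_iff_of_iso φ h2).2 h))]

variable (c)

/-- The classes of consistent networks. -/
def consistentClasses : Set (NetworkClass Ξ 1) :=
  {a | ∃ (G : Network Ξ) (o : G.V), a = rooted G o ∧ G.Consistent c}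

theorem rooted_mem_consistentClasses {G : Network Ξ} {o : G.V} :
    rooted G o ∈ consistentClasses c ↔ G.Consistent c := by
  refine ⟨?_, fun h => ⟨G, o, rfl, h⟩⟩
  rintro ⟨H, p, h, hH⟩
  obtain ⟨φ, -, h2, -⟩ := exists_iso_of_rooted_eq h
  exact hH.of_iso φ h2

/-- The transport from the first to the second distinguished vertex. -/
noncomputable def transportClass : NetworkClass Ξ 2 → X :=
  Quotient.lift (fun A : PointedNetwork Ξ 2 => A.toNetwork.transport c (A.root 0) (A.root 1)) (by
    rintro A B ⟨φ, -, h2, h3⟩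
    rw [Network.transport_eq_of_iso φ h2, h3, h3])

theorem transportClass_birooted (G : Network Ξ) (o v : G.V) :
    transportClass c (birooted G o v) = G.transport c o v := rfl

variable [MetricSpace Ξ] [TopologicalSpace X] [IsTopologicalGroup X]
variable {c}

/-- Walks with approximately equal products exist in close networks. -/
theorem exists_walkProd_mem (hc : Continuous c) {G : Network Ξ} {u v : G.V}
    (p : G.graph.Walk u v) : ∀ {O : Set X}, O ∈ 𝓝 (G.walkProd c p) →
    ∃ ε > 0, ∀ (H : Network Ξ) (s : Set G.V) (t : Set H.V)
      (φ : G.graph.induce s ≃g H.graph.induce t) (hs : ∀ x ∈ p.support, x ∈ s),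
      (∀ x y : s, G.graph.Adj x y → dist (G.edgeMark x y) (H.edgeMark (φ x) (φ y)) ≤ ε) →
      ∃ q : H.graph.Walk (φ ⟨u, hs u p.start_mem_support⟩ : H.V)
        (φ ⟨v, hs v p.end_mem_support⟩), H.walkProd c q ∈ O := by
  induction p with
  | nil =>
    intro O hO
    exact ⟨1, one_pos, fun H s t φ hs _ => ⟨.nil, mem_of_mem_nhds hO⟩⟩
  | @cons u w v h p ih =>
    intro O hO
    -- Continuity of multiplication splits the neighbourhood `O` into one for the first mark and one
    -- for the product along the rest of the walk.
    have hmul : Tendsto (fun z : X × X => z.1 * z.2)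
        (𝓝 (c (G.edgeMark u w)) ×ˢ 𝓝 (G.walkProd c p)) (𝓝 (G.walkProd c (.cons h p))) := by
      rw [← nhds_prod_eq]
      exact continuous_mul.tendsto _
    obtain ⟨O₁, hO₁, O₂, hO₂, hsub⟩ := mem_prod_iff.1 (hmul hO)
    obtain ⟨ε, hε, hwalk⟩ := ih hO₂
    obtain ⟨δ, hδ, hball⟩ := Metric.nhds_basis_closedBall.mem_iff.1
      (hc.continuousAt (x := G.edgeMark u w) hO₁)
    refine ⟨min ε δ, lt_min hε hδ, fun H s t φ hs he => ?_⟩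
    have hs' : ∀ x ∈ p.support, x ∈ s := fun x hx => hs x (by simp [hx])
    obtain ⟨q, hq⟩ := hwalk H s t φ hs' fun x y hxy => (he x y hxy).trans (min_le_left _ _)
    have hu : u ∈ s := hs u (by simp)
    have hw : w ∈ s := hs' w p.start_mem_support
    have hadj : H.graph.Adj (φ ⟨u, hu⟩ : H.V) (φ ⟨w, hw⟩) :=
      φ.map_rel_iff.2 (show (G.graph.induce s).Adj ⟨u, hu⟩ ⟨w, hw⟩ from h)
    refine ⟨.cons hadj q, hsub (mk_mem_prod (hball ?_) hq)⟩
    rw [Metric.mem_closedBall, dist_comm]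
    exact (he ⟨u, hu⟩ ⟨w, hw⟩ h).trans (min_le_right _ _)

theorem Network.exists_forall_mem_ball (G : Network Ξ) (o : G.V) {u v : G.V}
    (p : G.graph.Walk u v) : ∃ R : ℝ, 0 < R ∧ ∀ r > R, ∀ x ∈ p.support,
      G.graph.dist o x ≤ ⌈r⌉₊ := by
  refine ⟨1 + (p.support.map fun x => G.graph.dist o x).sum, by positivity, fun r hr x hx => ?_⟩
  have h1 : G.graph.dist o x ≤ (p.support.map fun x => G.graph.dist o x).sum :=
    List.single_le_sum (by simp) _ (List.mem_map_of_mem hx)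
  have h2 : (G.graph.dist o x : ℝ) ≤ (p.support.map fun x => G.graph.dist o x).sum := by
    exact_mod_cast h1
  have : (G.graph.dist o x : ℝ) ≤ ⌈r⌉₊ := by linarith [Nat.le_ceil r]
  exact_mod_cast this

/-- For large `r` the ball contains the whole walk and the mark tolerance `1 / r` drops below the
`ε` of `exists_walkProd_mem`. -/
theorem exists_walkProd_mem_of_close (hc : Continuous c) {k : ℕ} (A : PointedNetwork Ξ k)
    (i : Fin k) {u v : A.V} (p : A.graph.Walk u v) {O : Set X}
    (hO : O ∈ 𝓝 (A.toNetwork.walkProd c p)) :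
    ∃ R : ℝ, 0 < R ∧ ∀ r > R, ∃ hs : ∀ x ∈ p.support, x ∈ A.ball r, ∀ (B : PointedNetwork Ξ k)
      (φ : A.graph.induce (A.ball r) ≃g B.graph.induce (B.ball r)),
      (∀ x y : A.ball r, A.graph.Adj x y →
        dist (A.edgeMark x y) (B.edgeMark (φ x) (φ y)) ≤ 1 / r) →
      ∃ q : B.graph.Walk (φ ⟨u, hs u p.start_mem_support⟩ : B.V)
        (φ ⟨v, hs v p.end_mem_support⟩), B.toNetwork.walkProd c q ∈ O := by
  obtain ⟨ε, hε, h⟩ := exists_walkProd_mem hc p hO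
  obtain ⟨R, hR, hball⟩ := A.toNetwork.exists_forall_mem_ball (A.root i) p
  refine ⟨max R (1 / ε), lt_max_of_lt_left hR, fun r hr => ?_⟩
  have hs : ∀ x ∈ p.support, x ∈ A.ball r :=
    fun x hx => ⟨i, hball r ((le_max_left _ _).trans_lt hr) x hx⟩
  refine ⟨hs, fun B φ he => ?_⟩
  have hεr : 1 / ε < r := (le_max_right _ _).trans_lt hr
  have : 1 / r ≤ ε := (one_div_lt hε (lt_trans (by positivity) hεr)).1 hεr |>.le
  exact h B.toNetwork (A.ball r) (B.ball r) φ hs fun x y hxy => (he x y hxy).trans this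

variable [T2Space X]

/-- Inconsistency is witnessed by two walks with common ends and different products. Disjoint
neighbourhoods of the products keep them different in every close network. -/
theorem isClosed_consistentClasses (hc : Continuous c) :
    IsClosed (consistentClasses c : Set (NetworkClass Ξ 1)) := by
  refine ⟨fun A hA => ?_⟩
  rw [mk_eq_rooted] at hA
  have hA' : ¬ A.toNetwork.Consistent c := fun h => hA ((rooted_mem_consistentClasses c).2 h)
  rw [Network.Consistent] at hA'
  push Not at hA'
  obtain ⟨u, v, p, q, hpq⟩ := hA'
  obtain ⟨O₁, O₂, ho₁, ho₂, hm₁, hm₂, hdisj⟩ := t2_separation hpq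
  obtain ⟨R₁, hR₁, h₁⟩ := exists_walkProd_mem_of_close hc A 0 p (ho₁.mem_nhds hm₁)
  obtain ⟨R₂, hR₂, h₂⟩ := exists_walkProd_mem_of_close hc A 0 q (ho₂.mem_nhds hm₂)
  refine ⟨max R₁ R₂, lt_max_of_lt_left hR₁, fun r hr B ⟨φ, _, _, he⟩ => ?_⟩
  obtain ⟨_, h₁'⟩ := h₁ r ((le_max_left _ _).trans_lt hr)
  obtain ⟨_, h₂'⟩ := h₂ r ((le_max_right _ _).trans_lt hr)
  obtain ⟨p', hp'⟩ := h₁' B φ he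
  obtain ⟨q', hq'⟩ := h₂' B φ he
  rw [mk_eq_rooted]
  intro hB'
  have hB := (rooted_mem_consistentClasses c).1 hB'
  rw [hB _ _ p' q'] at hp'
  exact hdisj.notMem_of_mem_left hp' hq'

variable [MeasurableSpace X] [BorelSpace X]

/-- On the closed set of consistent classes the transport is relatively continuous, being the
product along one finite walk; off this set it is constantly `1`. -/
theorem measurable_transportClass (hc : Continuous c) :
    Measurable (transportClass c : NetworkClass Ξ 2 → X) := by
  have hC : IsClosed (forget ⁻¹' (consistentClasses c : Set (NetworkClass Ξ 1))) :=
    (isClosed_consistentClasses hc).preimage continuous_forget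
  refine measurable_of_isOpen fun O hO => ?_
  -- Adjoining the open set of inconsistent classes makes the preimage open: close networks either
  -- are consistent, with product in `O`, or are inconsistent.
  have hopen : IsOpen ((forget ⁻¹' (consistentClasses c : Set (NetworkClass Ξ 1)))ᶜ ∪
      transportClass c ⁻¹' O) := by
    intro A hA
    by_cases hAc : A.toNetwork.Consistent c
    · have hAO : A.toNetwork.transport c (A.root 0) (A.root 1) ∈ O :=
        hA.resolve_left fun h => h ((rooted_mem_consistentClasses c).2 hAc)
      obtain ⟨p⟩ := A.connected.preconnected (A.root 0) (A.root 1)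
      rw [hAc.transport_eq p] at hAO
      obtain ⟨R, hR, h⟩ := exists_walkProd_mem_of_close hc A 0 p (hO.mem_nhds hAO)
      refine ⟨R, hR, fun r hr B ⟨φ, hroot, _, he⟩ => ?_⟩
      by_cases hBc : B.toNetwork.Consistent c
      · refine Or.inr ?_
        obtain ⟨hs, h'⟩ := h r hr
        obtain ⟨q, hq⟩ := h' B φ he
        rw [← hBc.transport_eq q, hroot 0 _ rfl, hroot 1 _ rfl] at hq
        exact hq
      · exact Or.inl fun h => hBc ((rooted_mem_consistentClasses c).1 h)
    · obtain ⟨R, hR, h⟩ := hC.isOpen_compl A fun h => hAc ((rooted_mem_consistentClasses c).1 h)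
      exact ⟨R, hR, fun r hr B hB => Or.inl (h r hr B hB)⟩
  by_cases h1 : (1 : X) ∈ O
  · have : transportClass c ⁻¹' O = (forget ⁻¹' (consistentClasses c : Set (NetworkClass Ξ 1)))ᶜ ∪
        transportClass c ⁻¹' O := by
      refine (union_eq_right.2 fun b hb => ?_).symm
      obtain ⟨G, o, v, rfl⟩ := exists_eq_birooted b
      rw [mem_compl_iff, mem_preimage, forget_birooted, rooted_mem_consistentClasses] at hb
      rw [mem_preimage, transportClass_birooted, Network.transport, if_neg hb]
      exact h1
    rw [this]
    exact hopen.measurableSet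
  · have : transportClass c ⁻¹' O = ((forget ⁻¹' (consistentClasses c : Set (NetworkClass Ξ 1)))ᶜ ∪
        transportClass c ⁻¹' O) ∩ forget ⁻¹' (consistentClasses c : Set (NetworkClass Ξ 1)) := by
      ext b
      refine ⟨fun hb => ⟨Or.inr hb, ?_⟩, fun hb => hb.1.resolve_left fun h => h hb.2⟩
      obtain ⟨G, o, v, rfl⟩ := exists_eq_birooted b
      by_contra hcon
      rw [mem_preimage, forget_birooted, rooted_mem_consistentClasses] at hcon
      rw [mem_preimage, transportClass_birooted, Network.transport, if_neg hcon] at hb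
      exact h1 hb
    rw [this]
    exact hopen.measurableSet.inter hC.measurableSet

end Transport

/-! ### The embedding and its transition map -/

section Embedding

variable {X : Type*} [Group X] [TopologicalSpace X] [IsTopologicalGroup X]
  [LocallyCompactSpace X] [SecondCountableTopology X] [T2Space X]
  [MeasurableSpace X] [BorelSpace X] {Ξ : Type u} [MetricSpace Ξ] {c : Ξ → X}

variable (c) in
/-- The image of the vertices under the transport from the root. -/
noncomputable def transportMeasure (a : NetworkClass Ξ 1) : Measure X :=
  (vertexMeasure a).map (transportClass c)

theorem transportMeasure_apply (hc : Continuous c) (a : NetworkClass Ξ 1) {B : Set X}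
    (hB : MeasurableSet B) :
    transportMeasure c a B = massOut ((transportClass c ⁻¹' B).indicator 1) a := by
  rw [transportMeasure, Measure.map_apply (measurable_transportClass hc) hB,
    vertexMeasure_apply (measurable_transportClass hc hB)]

theorem transportMeasure_rooted (hc : Continuous c) (G : Network Ξ) (o : G.V) :
    transportMeasure c (rooted G o) = Measure.sum fun v => Measure.dirac (G.transport c o v) := by
  ext B hB
  rw [transportMeasure_apply hc _ hB, massOut_rooted, Measure.sum_apply _ hB]
  refine tsum_congr fun v => ?_
  rw [Measure.dirac_apply' _ hB]
  rfl

theorem measurable_transportMeasure (hc : Continuous c) :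
    Measurable (transportMeasure c : NetworkClass Ξ 1 → Measure X) :=
  (Measure.measurable_map _ (measurable_transportClass hc)).comp measurable_vertexMeasure

theorem exists_transportMeasure_eq_coe (hc : Continuous c) (a : NetworkClass Ξ 1) {B : Set X}
    (hB : MeasurableSet B) : ∃ n : ℕ∞, transportMeasure c a B = (n : ℝ≥0∞) := by
  obtain ⟨G, o, rfl⟩ := exists_eq_rooted a
  refine ⟨{v | G.transport c o v ∈ B}.encard, ?_⟩
  rw [← ENNReal.tsum_set_one, tsum_subtype _ (fun _ => (1 : ℝ≥0∞)), transportMeasure_rooted hc,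
    Measure.sum_apply _ hB]
  refine tsum_congr fun v => ?_
  rw [Measure.dirac_apply' _ hB]
  rfl

variable (c) in
/-- The classes of consistent networks whose image in the group is locally finite. -/
def embeddableClasses : Set (NetworkClass Ξ 1) :=
  consistentClasses c ∩ {a | IsLocallyFiniteMeasure (transportMeasure c a)}

/-- Local finiteness is finiteness on the countably many sets of a compact exhaustion, and each of
these is a measurable condition. -/
theorem measurableSet_embeddableClasses (hc : Continuous c) :
    MeasurableSet (embeddableClasses c : Set (NetworkClass Ξ 1)) := by
  refine (isClosed_consistentClasses hc).measurableSet.inter ?_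
  let K := CompactExhaustion.choice X
  have h : {a : NetworkClass Ξ 1 | IsLocallyFiniteMeasure (transportMeasure c a)} =
      ⋂ n, {a | transportMeasure c a (K n) < ∞} := by
    ext a
    simp only [mem_ofPred_eq, mem_iInter]
    refine ⟨fun _ n => (K.isCompact n).measure_lt_top, fun h => ⟨fun x => ?_⟩⟩
    obtain ⟨n, hn⟩ := K.exists_mem_nhds x
    exact ⟨K n, hn, h n⟩
  rw [h]
  refine MeasurableSet.iInter fun n => ?_
  exact measurableSet_lt ((Measure.measurable_coe (K.isCompact n).measurableSet).comp
    (measurable_transportMeasure hc)) measurable_const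

open Classical in
/-- The embedding of networks with consistent marks; all other networks are mapped to the Dirac
measure at the neutral element. -/
noncomputable def embedding (hc : Continuous c) (a : NetworkClass Ξ 1) : CountingMeasure X :=
  if h : a ∈ embeddableClasses c then
    ⟨transportMeasure c a, h.2, fun _ hB => exists_transportMeasure_eq_coe hc a hB⟩
  else ⟨Measure.dirac 1, inferInstance, fun B hB => by
    rw [Measure.dirac_apply' _ hB]
    by_cases h : (1 : X) ∈ B
    · exact ⟨1, by simp [h]⟩
    · exact ⟨0, by simp [h]⟩⟩

theorem coe_embedding (hc : Continuous c) {a : NetworkClass Ξ 1} (h : a ∈ embeddableClasses c) :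
    (embedding hc a : Measure X) = transportMeasure c a := by
  exact congrArg Subtype.val (dif_pos h)

theorem coe_embedding_of_notMem (hc : Continuous c) {a : NetworkClass Ξ 1}
    (h : a ∉ embeddableClasses c) : (embedding hc a : Measure X) = Measure.dirac 1 := by
  exact congrArg Subtype.val (dif_neg h)

theorem measurable_embedding (hc : Continuous c) :
    Measurable (embedding hc : NetworkClass Ξ 1 → CountingMeasure X) := by
  classical
  refine Measurable.subtype_mk (f := fun a => (embedding hc a : Measure X)) ?_
  have h : (fun a => (embedding hc a : Measure X)) = fun a : NetworkClass Ξ 1 =>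
      if a ∈ embeddableClasses c then transportMeasure c a else Measure.dirac 1 := by
    ext1 a
    split_ifs with ha
    exacts [coe_embedding hc ha, coe_embedding_of_notMem hc ha]
  rw [h]
  exact Measurable.ite (measurableSet_embeddableClasses hc) (measurable_transportMeasure hc)
    measurable_const

/-- This is the cocycle identity `transport o v * transport v w = transport o w`, read vertex by
vertex. -/
theorem transportMeasure_rooted_eq_leftTranslate (hc : Continuous c) {G : Network Ξ}
    (hG : G.Consistent c) (o v : G.V) : transportMeasure c (rooted G v) =
      leftTranslate (G.transport c o v)⁻¹ (transportMeasure c (rooted G o)) := by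
  ext B hB
  have hpre := measurable_const_mul (G.transport c o v)⁻¹ hB
  rw [leftTranslate, Measure.map_apply (measurable_const_mul _) hB, transportMeasure_rooted hc,
    transportMeasure_rooted hc, Measure.sum_apply _ hB, Measure.sum_apply _ hpre]
  refine tsum_congr fun w => ?_
  rw [Measure.dirac_apply' _ hB, Measure.dirac_apply' _ hpre, ← hG.transport_mul o v w]
  by_cases h : G.transport c v w ∈ B
  · rw [indicator_of_mem h, indicator_of_mem (by rwa [mem_preimage, inv_mul_cancel_left])]
    rfl
  · rw [indicator_of_notMem h, indicator_of_notMem (by rwa [mem_preimage, inv_mul_cancel_left])]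

theorem isLocallyFiniteMeasure_leftTranslate (x : X) (μ : Measure X) [IsLocallyFiniteMeasure μ] :
    IsLocallyFiniteMeasure (leftTranslate x μ) := by
  refine ⟨fun y => ?_⟩
  obtain ⟨U, hy, hU, hfin⟩ := μ.exists_isOpen_measure_lt_top (x⁻¹ * y)
  have hU' : IsOpen ((fun z => x⁻¹ * z) ⁻¹' U) := hU.preimage (continuous_const_mul _)
  refine ⟨_, hU'.mem_nhds hy, ?_⟩
  rw [leftTranslate, Measure.map_apply (measurable_const_mul x) hU'.measurableSet]
  convert hfin using 2
  ext z
  simp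

/-- Consistency does not involve the root, and moving the root only translates the image. This makes
the case distinctions in `embedding` and `transition` agree at all roots of one network. -/
theorem rooted_mem_embeddableClasses (hc : Continuous c) {G : Network Ξ} (o v : G.V)
    (h : rooted G o ∈ embeddableClasses c) : rooted G v ∈ embeddableClasses c := by
  have hG := (rooted_mem_consistentClasses c).1 h.1
  refine ⟨(rooted_mem_consistentClasses c).2 hG, ?_⟩
  have : IsLocallyFiniteMeasure (transportMeasure c (rooted G o)) := h.2
  rw [mem_ofPred_eq, transportMeasure_rooted_eq_leftTranslate hc hG o v]
  exact isLocallyFiniteMeasure_leftTranslate _ _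

open Classical in
variable (c) in
/-- The transition map of the embedding. -/
noncomputable def transition (b : NetworkClass Ξ 2) : X :=
  if forget b ∈ embeddableClasses c then transportClass c b else 1

theorem measurable_transition (hc : Continuous c) :
    Measurable (transition c : NetworkClass Ξ 2 → X) :=
  Measurable.ite (continuous_forget.measurable (measurableSet_embeddableClasses hc))
    (measurable_transportClass hc) measurable_const

theorem transition_birooted {G : Network Ξ} {o : G.V}
    (h : rooted G o ∈ embeddableClasses c) (v : G.V) :
    transition c (birooted G o v) = G.transport c o v := by
  rw [transition, forget_birooted, if_pos h, transportClass_birooted]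

theorem transition_birooted_of_notMem {G : Network Ξ} {o : G.V}
    (h : rooted G o ∉ embeddableClasses c) (v : G.V) : transition c (birooted G o v) = 1 := by
  rw [transition, forget_birooted, if_neg h]

theorem one_mem_points_embedding (hc : Continuous c) (a : NetworkClass Ξ 1) :
    (1 : X) ∈ points (embedding hc a) := by
  change (embedding hc a : Measure X) {1} ≠ 0
  by_cases h : a ∈ embeddableClasses c
  · rw [coe_embedding hc h]
    obtain ⟨G, o, rfl⟩ := exists_eq_rooted a
    have hG := (rooted_mem_consistentClasses c).1 h.1
    rw [transportMeasure_rooted hc, Measure.sum_apply _ (measurableSet_singleton _)]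
    refine fun h0 => ?_
    have := ENNReal.tsum_eq_zero.1 h0 o
    rw [hG.transport_self] at this
    simp at this
  · rw [coe_embedding_of_notMem hc h]
    simp

/-- Outside the embeddable classes both sides are the Dirac measure at `1`, because the transition
is `1` there; this default is what makes the identity hold for every network. -/
theorem embedding_rooted_eq_leftTranslate (hc : Continuous c) (G : Network Ξ) (o v : G.V) :
    (embedding hc (rooted G v) : Measure X) =
      leftTranslate (transition c (birooted G o v))⁻¹ (embedding hc (rooted G o)) := by
  by_cases h : rooted G o ∈ embeddableClasses c
  · rw [coe_embedding hc h, coe_embedding hc (rooted_mem_embeddableClasses hc o v h),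
      transition_birooted h]
    exact transportMeasure_rooted_eq_leftTranslate hc ((rooted_mem_consistentClasses c).1 h.1) o v
  · rw [coe_embedding_of_notMem hc h,
      coe_embedding_of_notMem hc (fun h' => h (rooted_mem_embeddableClasses hc v o h')),
      transition_birooted_of_notMem h]
    simp [leftTranslate]

theorem transition_symm (hc : Continuous c) (G : Network Ξ) (o v : G.V) :
    transition c (birooted G v o) = (transition c (birooted G o v))⁻¹ := by
  by_cases h : rooted G o ∈ embeddableClasses c
  · rw [transition_birooted h, transition_birooted (rooted_mem_embeddableClasses hc o v h)]
    exact ((rooted_mem_consistentClasses c).1 h.1).transport_symm o v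
  · rw [transition_birooted_of_notMem h, transition_birooted_of_notMem
      (fun h' => h (rooted_mem_embeddableClasses hc v o h')), inv_one]

end Embedding

/-- The isomorphism class of a network with distinguished vertices. -/
def PointedNetwork.toClass {Ξ : Type u} {k : ℕ} (A : PointedNetwork Ξ k) : NetworkClass Ξ k :=
  Quotient.mk _ A

/-! ### Finite patterns approximating balls -/

section Pattern

variable {Ξ : Type u} [MetricSpace Ξ] {k : ℕ}

/-- A finite approximation of the ball of radius `radius + 1` in a network: a graph on `Fin size`
with distinguished vertices, whose edge marks are given as indices of a dense sequence. -/
structure Pattern (k : ℕ) where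
  size : ℕ
  radius : ℕ
  adj : Fin size → Fin size → Bool
  root : Fin k → Fin size
  mark : Fin size → Fin size → ℕ

instance : Countable (Pattern k) := by
  let f : Pattern k → Σ n : ℕ, ℕ × (Fin n → Fin n → Bool) × (Fin k → Fin n) × (Fin n → Fin n → ℕ) :=
    fun d => ⟨d.size, d.radius, d.adj, d.root, d.mark⟩
  have hf : Function.Injective f := by
    rintro ⟨⟩ ⟨⟩ h
    simp only [f, Sigma.mk.injEq] at h
    obtain ⟨rfl, h⟩ := h
    simp only [heq_eq_eq, Prod.mk.injEq] at h
    obtain ⟨rfl, rfl, rfl, rfl⟩ := h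
    rfl
  exact hf.countable

/-- The ball in `A` is described by the pattern `d`. -/
def Pattern.Matches (q : ℕ → Ξ) (d : Pattern k) (A : PointedNetwork Ξ k) : Prop :=
  ∃ e : Fin d.size ≃ A.ball ((d.radius + 1 : ℕ) : ℝ),
    (∀ i j, d.adj i j = true ↔ A.graph.Adj (e i) (e j)) ∧
    (∀ l, (e (d.root l) : A.V) = A.root l) ∧
    ∀ i j, d.adj i j = true →
      dist (A.edgeMark (e i) (e j)) (q (d.mark i j)) ≤ 1 / (2 * ((d.radius + 1 : ℕ) : ℝ))

/-- Both networks have edge marks within `1 / (2 * r)` of the same reference marks, and the two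
errors add up to the allowed `1 / r`. Taking `r = radius + 1` keeps `r` positive. -/
theorem Pattern.Matches.close {q : ℕ → Ξ} {d : Pattern k} {A B : PointedNetwork Ξ k}
    (hA : d.Matches q A) (hB : d.Matches q B)
    (hv : ∀ v w, A.vertexMark v = B.vertexMark w) :
    A.Close ((d.radius + 1 : ℕ) : ℝ) B := by
  obtain ⟨e, h1, h2, h3⟩ := hA
  obtain ⟨e', h1', h2', h3'⟩ := hB
  have hpos : (0 : ℝ) < ((d.radius + 1 : ℕ) : ℝ) := by positivity
  have hadj : ∀ v w : A.ball ((d.radius + 1 : ℕ) : ℝ),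
      d.adj (e.symm v) (e.symm w) = true ↔ A.graph.Adj v w := fun v w => by
    rw [h1, Equiv.apply_symm_apply, Equiv.apply_symm_apply]
  refine ⟨⟨e.symm.trans e', fun {v w} => ?_⟩, fun i v hv => ?_, fun v => ?_, fun v w hvw => ?_⟩
  · exact (h1' _ _).symm.trans (hadj v w)
  · have : e.symm v = d.root i := by
      rw [Equiv.symm_apply_eq]
      exact Subtype.ext (hv.trans (h2 i).symm)
    change (e' (e.symm v) : B.V) = B.root i
    rw [this, h2']
  · rw [hv v, dist_self]
    positivity
  · have ha := (hadj v w).2 hvw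
    have h4 := h3 _ _ ha
    have h5 := h3' _ _ ha
    rw [Equiv.apply_symm_apply, Equiv.apply_symm_apply] at h4
    change dist (A.edgeMark v w) (B.edgeMark (e' (e.symm v)) (e' (e.symm w))) ≤ _
    refine (dist_triangle_right _ _ (q (d.mark (e.symm v) (e.symm w)))).trans
      ((add_le_add h4 h5).trans_eq ?_)
    field_simp
    norm_num

theorem PointedNetwork.finite_ball (A : PointedNetwork Ξ k) (r : ℝ) : (A.ball r).Finite := by
  have h : A.ball r = ⋃ i, {v | A.graph.dist (A.root i) v ≤ ⌈r⌉₊} := by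
    ext v
    simp [PointedNetwork.ball]
  rw [h]
  exact finite_iUnion fun i => finite_setOf_dist_le A.connected A.locallyFinite _ _

theorem exists_pattern_matches {q : ℕ → Ξ} (hq : DenseRange q) (A : PointedNetwork Ξ k) (n : ℕ) :
    ∃ d : Pattern k, d.radius = n ∧ d.Matches q A := by
  classical
  have hfin : Finite (A.ball ((n + 1 : ℕ) : ℝ)) := A.finite_ball _
  obtain ⟨p, ⟨e⟩⟩ := Finite.exists_equiv_fin (A.ball ((n + 1 : ℕ) : ℝ))
  have hpos : (0 : ℝ) < 1 / (2 * ((n + 1 : ℕ) : ℝ)) := by positivity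
  choose g hg using fun x : Ξ => hq.exists_dist_lt x hpos
  refine ⟨⟨p, n, fun i j => decide (A.graph.Adj (e.symm i) (e.symm j)),
    fun l => e ⟨A.root l, A.root_mem_ball _ l⟩, fun i j => g (A.edgeMark (e.symm i) (e.symm j))⟩,
    rfl, e.symm, fun i j => by simp, fun l => by simp, fun i j _ => (hg _).le⟩

end Pattern

/-! ### Measurability of network-valued maps -/

section Measurability

variable {X : Type u} [Group X] [TopologicalSpace X] [IsTopologicalGroup X]
  [LocallyCompactSpace X] [SecondCountableTopology X] [T2Space X]
  [MeasurableSpace X] [BorelSpace X]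
  {S : Type*} [MeasurableSpace S] {μ : S → CountingMeasure X}

/-- Points are quantified one at a time: by `measurableSet_exists_mem_points`, the existence of one
point is positivity of a kernel. -/
theorem measurableSet_exists_tuple (hμ : Measurable μ) (p : ℕ) :
    ∀ {T : Set (S × (Fin p → X))}, MeasurableSet T →
      MeasurableSet {s | ∃ f : Fin p → X, (∀ i, f i ∈ points (μ s)) ∧ (s, f) ∈ T} := by
  induction p with
  | zero =>
    intro T hT
    have h : {s | ∃ f : Fin 0 → X, (∀ i, f i ∈ points (μ s)) ∧ (s, f) ∈ T} =
        (fun s => (s, (Fin.elim0 : Fin 0 → X))) ⁻¹' T := by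
      ext s
      constructor
      · rintro ⟨f, -, hf⟩
        rwa [Subsingleton.elim f Fin.elim0] at hf
      · exact fun h => ⟨_, fun i => i.elim0, h⟩
    rw [h]
    exact measurable_prodMk_right hT
  | succ p ih =>
    intro T hT
    have hcons : Measurable fun a : (S × (Fin p → X)) × X =>
        (a.1.1, (Fin.cons a.2 a.1.2 : Fin (p + 1) → X)) := by
      refine Measurable.prodMk (by fun_prop) (measurable_pi_lambda _ fun i => ?_)
      refine Fin.cases ?_ (fun j => ?_) i
      · simpa using measurable_snd
      · simp only [Fin.cons_succ]
        fun_prop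
    have hT' := ih (measurableSet_exists_mem_points hμ
      (ρ := (Prod.fst : S × (Fin p → X) → S)) measurable_fst (hcons hT))
    convert hT' using 1
    ext s
    constructor
    · rintro ⟨f, hf, hfT⟩
      refine ⟨Fin.tail f, fun i => hf _, f 0, hf 0, ?_⟩
      simpa [Fin.cons_self_tail] using hfT
    · rintro ⟨f, hf, x, hx, hfT⟩
      exact ⟨Fin.cons x f, fun i => Fin.cases hx hf i, hfT⟩

/-- The pairs of points that are joined by a walk of length `n`. -/
def walkSet (μ : S → CountingMeasure X) (E : Set (S × X × X)) : ℕ → Set (S × X × X)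
  | 0 => {p | p.2.1 = p.2.2}
  | n + 1 => {p | ∃ z ∈ points (μ p.1), (p.1, p.2.1, z) ∈ E ∧ (p.1, z, p.2.2) ∈ walkSet μ E n}

theorem measurableSet_walkSet (hμ : Measurable μ) {E : Set (S × X × X)} (hE : MeasurableSet E)
    (n : ℕ) : MeasurableSet (walkSet μ E n) := by
  induction n with
  | zero => exact measurableSet_eq_fun (by fun_prop) (by fun_prop)
  | succ n ih =>
    refine measurableSet_exists_mem_points hμ (ρ := (Prod.fst : S × X × X → S)) measurable_fst
      (T := {a | (a.1.1, a.1.2.1, a.2) ∈ E ∧ (a.1.1, a.2, a.1.2.2) ∈ walkSet μ E n}) ?_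
    have h1 : Measurable fun a : (S × X × X) × X => (a.1.1, a.1.2.1, a.2) := by fun_prop
    have h2 : Measurable fun a : (S × X × X) × X => (a.1.1, a.2, a.1.2.2) := by fun_prop
    exact (h1 hE).inter (h2 ih)

/-- Since `ι` maps onto the points, each intermediate point comes from a vertex. This expresses
graph distance by the measurable edge set alone. -/
theorem mem_walkSet_iff {E : Set (S × X × X)} {s : S} {V : Type*} {G : SimpleGraph V} {ι : V → X}
    (hι : Function.Injective ι) (hrange : range ι = points (μ s))
    (hE : ∀ v w, G.Adj v w ↔ (s, ι v, ι w) ∈ E) (n : ℕ) : ∀ v w : V,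
    (s, ι v, ι w) ∈ walkSet μ E n ↔ ∃ p : G.Walk v w, p.length = n := by
  induction n with
  | zero =>
    intro v w
    constructor
    · intro h
      obtain rfl := hι h
      exact ⟨.nil, rfl⟩
    · rintro ⟨p, hp⟩
      exact congrArg ι (SimpleGraph.Walk.eq_of_length_eq_zero hp)
  | succ n ih =>
    intro v w
    constructor
    · rintro ⟨z, hz, h1, h2⟩
      rw [← hrange] at hz
      obtain ⟨a, rfl⟩ := hz
      obtain ⟨p, hp⟩ := (ih a w).1 h2
      exact ⟨.cons ((hE v a).2 h1) p, by simp [hp]⟩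
    · rintro ⟨p, hp⟩
      cases p with
      | nil => simp at hp
      | @cons _ a _ h p =>
        refine ⟨ι a, hrange ▸ mem_range_self a, (hE v a).1 h, (ih a w).2 ⟨p, ?_⟩⟩
        simpa using hp

variable {Ξ : Type*} [MetricSpace Ξ] [MeasurableSpace Ξ] [OpensMeasurableSpace Ξ] {k : ℕ}

/-- The tuples of points that realise the pattern `d`. -/
def patternSet (μ : S → CountingMeasure X) (E : Set (S × X × X)) (r : Fin k → S → X)
    (e : X → X → Ξ) (q : ℕ → Ξ) (d : Pattern k) : Set (S × (Fin d.size → X)) :=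
  {a | (∀ i j, a.2 i = a.2 j → i = j) ∧
    (∀ i j, d.adj i j = true ↔ (a.1, a.2 i, a.2 j) ∈ E) ∧
    (∀ l, a.2 (d.root l) = r l a.1) ∧
    (∀ i j, d.adj i j = true →
      dist (e (a.2 i) (a.2 j)) (q (d.mark i j)) ≤ 1 / (2 * ((d.radius + 1 : ℕ) : ℝ))) ∧
    ∀ y ∈ points (μ a.1), (∃ l, ∃ n ≤ d.radius + 1, (a.1, r l a.1, y) ∈ walkSet μ E n) ↔
      ∃ i, y = a.2 i}

theorem measurableSet_patternSet (hμ : Measurable μ) {E : Set (S × X × X)} (hE : MeasurableSet E)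
    {r : Fin k → S → X} (hr : ∀ l, Measurable (r l)) {e : X → X → Ξ}
    (he : Measurable (Function.uncurry e)) (q : ℕ → Ξ) (d : Pattern k) :
    MeasurableSet (patternSet μ E r e q d) := by
  have hprop : ∀ (p : Prop) {A : Set (S × (Fin d.size → X))}, MeasurableSet A →
      MeasurableSet {a | p ↔ a ∈ A} := by
    intro p A hA
    by_cases hp : p
    · simpa [hp] using hA
    · simp only [hp, false_iff]
      exact hA.compl
  have himp : ∀ (p : Prop) {A : Set (S × (Fin d.size → X))}, MeasurableSet A →
      MeasurableSet {a | p → a ∈ A} := by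
    intro p A hA
    by_cases hp : p
    · simpa [hp] using hA
    · simp [hp]
  have h1 : MeasurableSet {a : S × (Fin d.size → X) | ∀ i j, a.2 i = a.2 j → i = j} := by
    have : {a : S × (Fin d.size → X) | ∀ i j, a.2 i = a.2 j → i = j} =
        ⋂ (i) (j) , {a | ¬ i = j → a ∈ {a : S × (Fin d.size → X) | a.2 i = a.2 j}ᶜ} := by
      ext a
      simp only [mem_ofPred_eq, mem_iInter, mem_compl_iff, not_imp_not]
    rw [this]
    exact MeasurableSet.iInter fun i => MeasurableSet.iInter fun j =>
      himp _ (measurableSet_eq_fun (by fun_prop) (by fun_prop)).compl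
  have h2 : MeasurableSet {a : S × (Fin d.size → X) |
      ∀ i j, d.adj i j = true ↔ (a.1, a.2 i, a.2 j) ∈ E} := by
    simp only [ofPred_forall]
    refine MeasurableSet.iInter fun i => MeasurableSet.iInter fun j => hprop _ ?_
    have h : Measurable fun a : S × (Fin d.size → X) => (a.1, a.2 i, a.2 j) := by fun_prop
    exact h hE
  have h3 : MeasurableSet {a : S × (Fin d.size → X) | ∀ l, a.2 (d.root l) = r l a.1} := by
    simp only [ofPred_forall]
    exact MeasurableSet.iInter fun l => measurableSet_eq_fun (by fun_prop)
      ((hr l).comp measurable_fst)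
  have h4 : MeasurableSet {a : S × (Fin d.size → X) | ∀ i j, d.adj i j = true →
      dist (e (a.2 i) (a.2 j)) (q (d.mark i j)) ≤ 1 / (2 * ((d.radius + 1 : ℕ) : ℝ))} := by
    simp only [ofPred_forall]
    refine MeasurableSet.iInter fun i => MeasurableSet.iInter fun j => MeasurableSet.iInter fun _ =>
      ?_
    have h : Measurable fun a : S × (Fin d.size → X) => e (a.2 i) (a.2 j) :=
      he.comp (f := fun a : S × (Fin d.size → X) => (a.2 i, a.2 j)) (by fun_prop)
    exact (Metric.isClosed_closedBall (x := q (d.mark i j))).measurableSet.preimage h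
  -- The equivalence holds at all points exactly if no point lies in the symmetric difference of
  -- `B₁` and `B₂`, which reduces the universal quantifier to an existential one.
  have h5 : MeasurableSet {a : S × (Fin d.size → X) | ∀ y ∈ points (μ a.1),
      (∃ l, ∃ n ≤ d.radius + 1, (a.1, r l a.1, y) ∈ walkSet μ E n) ↔ ∃ i, y = a.2 i} := by
    let B₁ : Set ((S × (Fin d.size → X)) × X) :=
      ⋃ l, ⋃ n, ⋃ (_ : n ≤ d.radius + 1), {b | (b.1.1, r l b.1.1, b.2) ∈ walkSet μ E n}
    let B₂ : Set ((S × (Fin d.size → X)) × X) := ⋃ i, {b | b.2 = b.1.2 i}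
    have hB₁ : MeasurableSet B₁ := by
      refine MeasurableSet.iUnion fun l => MeasurableSet.iUnion fun n =>
        MeasurableSet.iUnion fun _ => ?_
      have h : Measurable fun b : (S × (Fin d.size → X)) × X => (b.1.1, r l b.1.1, b.2) := by
        have := hr l
        fun_prop
      exact h (measurableSet_walkSet hμ hE n)
    have hB₂ : MeasurableSet B₂ :=
      MeasurableSet.iUnion fun i => measurableSet_eq_fun (by fun_prop) (by fun_prop)
    have h := (measurableSet_exists_mem_points hμ
      (ρ := (Prod.fst : S × (Fin d.size → X) → S)) measurable_fst
      ((hB₁.diff hB₂).union (hB₂.diff hB₁))).compl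
    convert h using 1
    ext a
    simp only [mem_ofPred_eq, mem_compl_iff, not_exists, not_and]
    refine forall₂_congr fun y _ => ?_
    have e₁ : (∃ l, ∃ n ≤ d.radius + 1, (a.1, r l a.1, y) ∈ walkSet μ E n) ↔ (a, y) ∈ B₁ := by
      simp only [B₁, mem_iUnion, exists_prop, mem_ofPred_eq]
    have e₂ : (∃ i, y = a.2 i) ↔ (a, y) ∈ B₂ := by
      simp only [B₂, mem_iUnion, mem_ofPred_eq]
    rw [e₁, e₂, mem_union, Set.mem_sdiff, Set.mem_sdiff]
    tauto
  exact h1.inter (h2.inter (h3.inter (h4.inter h5)))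

/-- A family of isomorphism classes of networks on the points of a point process is measurable,
if the roots, the edges and the marks depend measurably on the parameter. -/
theorem measurable_networkClass {Ξ : Type u} [MetricSpace Ξ] [MeasurableSpace Ξ]
    [OpensMeasurableSpace Ξ] [TopologicalSpace.SeparableSpace Ξ] (hμ : Measurable μ)
    {E : Set (S × X × X)} (hE : MeasurableSet E) {r : Fin k → S → X} (hr : ∀ l, Measurable (r l))
    {e : X → X → Ξ} (he : Measurable (Function.uncurry e)) (N : S → PointedNetwork Ξ k)
    (ι : ∀ s, (N s).V → X) (hι : ∀ s, Function.Injective (ι s))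
    (hrange : ∀ s, range (ι s) = points (μ s))
    (hadj : ∀ s v w, (N s).graph.Adj v w ↔ (s, ι s v, ι s w) ∈ E)
    (hroot : ∀ s l, ι s ((N s).root l) = r l s)
    (hmark : ∀ s v w, (N s).edgeMark v w = e (ι s v) (ι s w))
    {ξ : Ξ} (hvertex : ∀ s v, (N s).vertexMark v = ξ) :
    Measurable fun s => (N s).toClass := by
  have : Nonempty Ξ := ⟨ξ⟩
  obtain ⟨q, hq⟩ := TopologicalSpace.exists_dense_seq Ξ
  have hmatch : ∀ (d : Pattern k) (s : S), d.Matches q (N s) ↔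
      ∃ f : Fin d.size → X, (∀ i, f i ∈ points (μ s)) ∧ (s, f) ∈ patternSet μ E r e q d := by
    intro d s
    have hball : ∀ v, (∃ l, ∃ n ≤ d.radius + 1, (s, r l s, ι s v) ∈ walkSet μ E n) ↔
        v ∈ (N s).ball ((d.radius + 1 : ℕ) : ℝ) := by
      intro v
      refine exists_congr fun l => ?_
      rw [Nat.ceil_natCast, ← hroot]
      constructor
      · rintro ⟨n, hn, h⟩
        obtain ⟨p, hp⟩ := (mem_walkSet_iff (hι s) (hrange s) (hadj s) n _ _).1 h
        exact (SimpleGraph.dist_le p).trans (hp.trans_le hn)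
      · intro h
        obtain ⟨p, hp⟩ := (N s).connected.exists_walk_length_eq_dist ((N s).root l) v
        exact ⟨_, h, (mem_walkSet_iff (hι s) (hrange s) (hadj s) _ _ _).2 ⟨p, hp⟩⟩
    constructor
    · rintro ⟨ε, h1, h2, h3⟩
      refine ⟨fun i => ι s (ε i), fun i => hrange s ▸ mem_range_self _, ?_, ?_, ?_, ?_, ?_⟩
      · exact fun i j h => ε.injective (Subtype.ext (hι s h))
      · exact fun i j => (h1 i j).trans (hadj _ _ _)
      · exact fun l => by rw [← hroot]; exact congrArg _ (h2 l)
      · exact fun i j h => by simpa only [hmark] using h3 i j h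
      · intro y hy
        change y ∈ points (μ s) at hy
        rw [← hrange] at hy
        obtain ⟨v, rfl⟩ := hy
        refine (hball v).trans ⟨fun hv => ⟨ε.symm ⟨v, hv⟩, by simp⟩, ?_⟩
        rintro ⟨i, hi⟩
        rw [hι s hi]
        exact (ε i).2
    · rintro ⟨f, hf, h0, h1, h2, h3, h4⟩
      have hf' : ∀ i, ∃ v, ι s v = f i := fun i => by
        have := hf i
        rwa [← hrange] at this
      choose g hg using hf'
      have hgball : ∀ i, g i ∈ (N s).ball ((d.radius + 1 : ℕ) : ℝ) := fun i => by
        rw [← hball, hg]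
        exact (h4 _ (hf i)).2 ⟨i, rfl⟩
      have hbij : Function.Bijective
          (fun i => (⟨g i, hgball i⟩ : (N s).ball ((d.radius + 1 : ℕ) : ℝ))) := by
        constructor
        · intro i j h
          refine h0 i j ?_
          change f i = f j
          rw [← hg i, ← hg j]
          exact congrArg (fun v : (N s).ball ((d.radius + 1 : ℕ) : ℝ) => ι s v) h
        · rintro ⟨v, hv⟩
          obtain ⟨i, hi⟩ := (h4 (ι s v) (hrange s ▸ mem_range_self v)).1 ((hball v).2 hv)
          exact ⟨i, Subtype.ext (hι s ((hg i).trans hi.symm))⟩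
      refine ⟨Equiv.ofBijective _ hbij, fun i j => ?_, fun l => hι s ?_, fun i j h => ?_⟩
      · refine (h1 i j).trans ?_
        rw [hadj]
        change _ ↔ (s, ι s (g i), ι s (g j)) ∈ E
        rw [hg, hg]
      · exact (hg _).trans ((h2 l).trans (hroot s l).symm)
      · rw [hmark]
        change dist (e (ι s (g i)) (ι s (g j))) _ ≤ _
        rw [hg, hg]
        exact h3 i j h
  refine measurable_of_isOpen fun U hU => ?_
  -- `D` collects the patterns that force membership in `U` within the family. There are countably
  -- many, and each `s` in the preimage matches one of them once the radius is large: any other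
  -- member with the same pattern is then close, vertex marks being constant across the family.
  let D : Set (Pattern k) := {d | ∀ s, d.Matches q (N s) → (N s).toClass ∈ U}
  have hUD : (fun s => (N s).toClass) ⁻¹' U =
      ⋃ d ∈ D, {s | d.Matches q (N s)} := by
    ext s
    simp only [mem_preimage, mem_iUnion, mem_ofPred_eq, exists_prop]
    refine ⟨fun hs => ?_, fun ⟨d, hd, hs⟩ => hd s hs⟩
    obtain ⟨R, -, hRU⟩ := hU _ hs
    obtain ⟨d, hd, hmd⟩ := exists_pattern_matches hq (N s) ⌈R⌉₊
    refine ⟨d, fun s' hs' => hRU ((d.radius + 1 : ℕ) : ℝ) ?_ _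
      (hmd.close hs' fun v w => by rw [hvertex, hvertex]), hmd⟩
    rw [hd]
    push_cast
    linarith [Nat.le_ceil R]
  rw [hUD]
  refine MeasurableSet.biUnion (to_countable _) fun d _ => ?_
  simp only [hmatch]
  exact measurableSet_exists_tuple hμ d.size (measurableSet_patternSet hμ hE hr he q d)

end Measurability

/-! ### Replacing almost sure events by invariant ones -/

section InvariantCore

variable {X : Type u} [Group X] [TopologicalSpace X] [IsTopologicalGroup X]
  [LocallyCompactSpace X] [SecondCountableTopology X] [T2Space X]
  [MeasurableSpace X] [BorelSpace X]
  {Ω : Type v} [MeasurableSpace Ω] [MulAction X Ω] [MeasurableSMul₂ X Ω]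

/-- The points almost all of whose translates lie in `A`. -/
def invariantCore (haar : Measure X) (A : Set Ω) : Set Ω :=
  {ω | haar {z | z • ω ∉ A} = 0}

variable {haar : Measure X} [haar.IsHaarMeasure] {A : Set Ω}

theorem measurableSet_invariantCore (hA : MeasurableSet A) :
    MeasurableSet (invariantCore haar A) := by
  have h : MeasurableSet {p : Ω × X | p.2 • p.1 ∈ Aᶜ} :=
    (show Measurable fun p : Ω × X => p.2 • p.1 by fun_prop) hA.compl
  exact measurable_measure_prodMk_left h (measurableSet_singleton 0)

/-- Moving `ω` by `x` multiplies the set of bad `z` on the right, hence right invariance. -/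
theorem smul_mem_invariantCore [haar.IsMulRightInvariant] (x : X) {ω : Ω}
    (h : ω ∈ invariantCore haar A) : x • ω ∈ invariantCore haar A := by
  have h' : haar {z | z • ω ∉ A} = 0 := h
  rw [← measure_preimage_mul_right haar x] at h'
  have hpre : {z : X | z • x • ω ∉ A} = (fun z => z * x) ⁻¹' {z | z • ω ∉ A} := by
    ext z
    simp [smul_smul]
  exact (congrArg haar hpre).trans h'

/-- Fubini: for each fixed `z` the bad `ω` are null because `P` is invariant, so for almost every
`ω` the bad `z` are null. -/
theorem measure_compl_invariantCore {P : Measure Ω} [SFinite P] [SMulInvariantMeasure X Ω P]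
    (hA : MeasurableSet A) (hP : P Aᶜ = 0) : P (invariantCore haar A)ᶜ = 0 := by
  have hT : MeasurableSet {p : Ω × X | p.2 • p.1 ∈ Aᶜ} :=
    (show Measurable fun p : Ω × X => p.2 • p.1 by fun_prop) hA.compl
  have h0 : (P.prod haar) {p : Ω × X | p.2 • p.1 ∈ Aᶜ} = 0 := by
    rw [Measure.prod_apply_symm hT]
    refine (lintegral_congr fun z => ?_).trans lintegral_zero
    exact (measure_preimage_smul_of_nullMeasurableSet hA.compl.nullMeasurableSet z).trans hP
  have := Measure.measure_ae_null_of_prod_null h0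
  exact this

theorem exists_smul_mem_of_mem_invariantCore {ω : Ω} (h : ω ∈ invariantCore haar A) :
    ∃ z : X, z • ω ∈ A := by
  have h' : ∀ᵐ z ∂haar, z • ω ∈ A := h
  exact h'.exists

/-- The triples `(ω, x, y)` such that a non-null set of translates lies in `F`. -/
def averagedSet (haar : Measure X) (F : Set (Ω × X × X)) : Set (Ω × X × X) :=
  {p | haar {z | (z • p.1, z * p.2.1, z * p.2.2) ∈ F} ≠ 0}

theorem measurableSet_averagedSet {F : Set (Ω × X × X)} (hF : MeasurableSet F) :
    MeasurableSet (averagedSet haar F) := by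
  have h : MeasurableSet {a : (Ω × X × X) × X | (a.2 • a.1.1, a.2 * a.1.2.1, a.2 * a.1.2.2) ∈ F} :=
    (show Measurable fun a : (Ω × X × X) × X => (a.2 • a.1.1, a.2 * a.1.2.1, a.2 * a.1.2.2) by
      fun_prop) hF
  exact (measurable_measure_prodMk_left h (measurableSet_singleton 0)).compl

/-- An equivariant relation has the same truth value at almost every shift, and for `ω` in the core
almost every shift lands where `F` is correct. So the `z` with shifted triple in `F` form a conull
or a null set, and these differ as Haar measure is nonzero. -/
theorem mem_averagedSet_iff {F : Set (Ω × X × X)} {r : Ω → X → X → Prop}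
    (hr : ∀ (z : X) ω x y, r ω x y ↔ r (z • ω) (z * x) (z * y))
    (hF : ∀ ω ∈ A, ∀ x y, (ω, x, y) ∈ F ↔ r ω x y) {ω : Ω} (h : ω ∈ invariantCore haar A)
    (x y : X) : (ω, x, y) ∈ averagedSet haar F ↔ r ω x y := by
  have h' : ∀ᵐ z ∂haar, z • ω ∈ A := h
  have hae : ∀ᵐ z ∂haar, ((z • ω, z * x, z * y) ∈ F ↔ r ω x y) := by
    filter_upwards [h'] with z hz
    rw [hF _ hz, ← hr]
  change haar {z | (z • ω, z * x, z * y) ∈ F} ≠ 0 ↔ _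
  by_cases hxy : r ω x y
  · refine iff_of_true (fun h0 => ?_) hxy
    have h1 : ∀ᵐ z ∂haar, (z • ω, z * x, z * y) ∉ F := measure_eq_zero_iff_ae_notMem.1 h0
    obtain ⟨z, h2, h3⟩ := (hae.and h1).exists
    exact h3 (h2.2 hxy)
  · refine iff_of_false (not_not.2 ?_) hxy
    refine measure_eq_zero_iff_ae_notMem.2 ?_
    filter_upwards [hae] with z hz hzF
    exact hxy (hz.1 hzF)

end InvariantCore

/-! ### An invariant event carrying a measurable graph -/

section GraphOnPoints

variable {X : Type u} [Group X] [TopologicalSpace X] [IsTopologicalGroup X]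
  [LocallyCompactSpace X] [SecondCountableTopology X] [T2Space X]
  [MeasurableSpace X] [BorelSpace X]
  {Ω : Type v} [MeasurableSpace Ω] [MulAction X Ω] [MeasurableSMul₂ X Ω]

/-- The random graph commutes with translations. -/
def EquivariantGraph (G : Ω → (⊤ : SimpleGraph X).Subgraph) : Prop :=
  ∀ (z : X) (ω : Ω),
    (∀ x : X, x ∈ (G ω).verts ↔ z * x ∈ (G (z • ω)).verts) ∧
    (∀ x y : X, (G ω).Adj x y ↔ (G (z • ω)).Adj (z * x) (z * y))

/-- The translation as an isomorphism of graphs. -/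
def EquivariantGraph.iso {G : Ω → (⊤ : SimpleGraph X).Subgraph} (hG : EquivariantGraph G) (z : X)
    (ω : Ω) : (G ω).coe ≃g (G (z • ω)).coe where
  toFun v := ⟨z * v, ((hG z ω).1 v).1 v.2⟩
  invFun v := ⟨z⁻¹ * v, ((hG z ω).1 _).2 (by rw [mul_inv_cancel_left]; exact v.2)⟩
  left_inv v := by simp
  right_inv v := by simp
  map_rel_iff' {v w} := ((hG z ω).2 v w).symm

/-- On the event `A` the random graph `G` is a connected locally finite graph on the points of the
simple process `m`, with edges `E`. -/
structure IsGoodEvent (m : Ω → CountingMeasure X) (G : Ω → (⊤ : SimpleGraph X).Subgraph)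
    (A : Set Ω) (E : Set (Ω × X × X)) : Prop where
  equivariant : EquivariantGraph G
  measurableSet : MeasurableSet A
  measurableSet_edges : MeasurableSet E
  smul_mem : ∀ (z : X), ∀ ω ∈ A, z • ω ∈ A
  simple : ∀ ω ∈ A, IsSimple (m ω)
  preconnected : ∀ ω ∈ A, (G ω).coe.Preconnected
  finite : ∀ ω ∈ A, ∀ x ∈ (G ω).verts, ((G ω).neighborSet x).Finite
  verts_eq : ∀ ω ∈ A, (G ω).verts = points (m ω)
  adj_iff : ∀ ω ∈ A, ∀ x y, (ω, x, y) ∈ E ↔ (G ω).Adj x y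

theorem FlowAdapted.isSimple_of_smul {m : Ω → CountingMeasure X} (hfa : FlowAdapted m) {z : X}
    {ω : Ω} (h : IsSimple (m (z • ω))) : IsSimple (m ω) := by
  intro x hx
  have h1 := h (z * x) ((hfa.mul_mem_points_smul z ω x).2 hx)
  rw [hfa z ω, leftTranslate,
    Measure.map_apply (measurable_const_mul z) (measurableSet_singleton _)] at h1
  rw [← h1]
  congr 1
  ext y
  simp

/-- The enumeration `Y` need not be equivariant and the almost sure event need not be invariant, so
neither passes to the Palm measure as it stands. Averaging over shifts repairs both. -/
theorem exists_isGoodEvent {P : Measure Ω} [SFinite P] [SMulInvariantMeasure X Ω P]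
    {haar : Measure X} [haar.IsHaarMeasure] [haar.IsMulRightInvariant]
    {m : Ω → CountingMeasure X} (hm : Measurable m) (hfa : FlowAdapted m)
    (hs : ∀ᵐ ω ∂P, IsSimple (m ω)) (hcon : Connectible P m) {w : X → ℝ≥0} (hw : Measurable w) :
    ∃ (G : Ω → (⊤ : SimpleGraph X).Subgraph) (A : Set Ω) (E : Set (Ω × X × X)),
      IsGoodEvent m G A E ∧ ∀ᵐ ω ∂(palm P haar m w), ω ∈ A := by
  obtain ⟨G, hG, hae, N, Y, -, hY, hsum, hedge⟩ := hcon
  have hgood := (hs.and hae).and hsum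
  obtain ⟨B, hB, hBm, hB0⟩ := exists_measurable_superset_of_null (ae_iff.1 hgood)
  have hmem : ∀ ω ∈ Bᶜ, (IsSimple (m ω) ∧ (G ω).coe.Preconnected ∧
      (∀ x ∈ (G ω).verts, ((G ω).neighborSet x).Finite) ∧ (G ω).verts = points (m ω)) ∧
      (m ω : Measure X) = Measure.sum
        (fun i : {i : ℕ // (i : ℕ∞) < N ω} => Measure.dirac (Y i ω)) := by
    intro ω hω
    by_contra hcon
    exact hω (hB hcon)
  -- Adjacency is known to be measurable only through the enumeration; `F` reads the edges off the
  -- indices and is claimed correct only outside the null set `B`.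
  let F : Set (Ω × X × X) := ⋃ (i : ℕ) (j : ℕ), {p | Y i p.1 = p.2.1} ∩ {p | Y j p.1 = p.2.2} ∩
    Prod.fst ⁻¹' {ω | (i : ℕ∞) < N ω ∧ (j : ℕ∞) < N ω ∧ (G ω).Adj (Y i ω) (Y j ω)}
  have hFm : MeasurableSet F := by
    refine MeasurableSet.iUnion fun i => MeasurableSet.iUnion fun j => ?_
    refine MeasurableSet.inter (MeasurableSet.inter ?_ ?_) (measurable_fst (hedge i j))
    · exact measurableSet_eq_fun ((hY i).comp measurable_fst) (by fun_prop)
    · exact measurableSet_eq_fun ((hY j).comp measurable_fst) (by fun_prop)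
  have hF : ∀ ω ∈ Bᶜ, ∀ x y, (ω, x, y) ∈ F ↔ (G ω).Adj x y := by
    intro ω hω x y
    obtain ⟨⟨-, -, -, hv⟩, hms⟩ := hmem ω hω
    have hpt : ∀ x ∈ (G ω).verts, ∃ i : ℕ, (i : ℕ∞) < N ω ∧ Y i ω = x := by
      intro x hx
      rw [hv] at hx
      have hx' : (m ω : Measure X) {x} ≠ 0 := hx
      rw [hms, Measure.sum_apply _ (measurableSet_singleton x), Ne, ENNReal.tsum_eq_zero] at hx'
      push Not at hx'
      obtain ⟨i, hi⟩ := hx'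
      refine ⟨i, i.2, ?_⟩
      by_contra hne
      rw [Measure.dirac_apply' _ (measurableSet_singleton x),
        indicator_of_notMem (show Y i ω ∉ ({x} : Set X) from hne)] at hi
      exact hi rfl
    simp only [F, mem_iUnion]
    constructor
    · rintro ⟨i, j, ⟨hi, hj⟩, -, -, hadj⟩
      rw [← show Y i ω = x from hi, ← show Y j ω = y from hj]
      exact hadj
    · intro hadj
      obtain ⟨i, hi, rfl⟩ := hpt x ((G ω).edge_vert hadj)
      obtain ⟨j, hj, rfl⟩ := hpt y ((G ω).edge_vert hadj.symm)
      exact ⟨i, j, ⟨rfl, rfl⟩, hi, hj, hadj⟩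
  have hG' : EquivariantGraph G := hG
  refine ⟨G, invariantCore haar Bᶜ, averagedSet haar F, ⟨hG', ?_, ?_, ?_, ?_, ?_, ?_, ?_, ?_⟩, ?_⟩
  · exact measurableSet_invariantCore hBm.compl
  · exact measurableSet_averagedSet hFm
  · exact fun z ω hω => smul_mem_invariantCore z hω
  -- This property and the next three hold at some shift of `ω` lying outside `B`, and equivariance
  -- carries them back to `ω`.
  · intro ω hω
    obtain ⟨z, hz⟩ := exists_smul_mem_of_mem_invariantCore hω
    exact hfa.isSimple_of_smul (hmem _ hz).1.1
  · intro ω hω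
    obtain ⟨z, hz⟩ := exists_smul_mem_of_mem_invariantCore hω
    exact (hmem _ hz).1.2.1.map (hG'.iso z ω).symm.toHom (hG'.iso z ω).symm.surjective
  · intro ω hω x hx
    obtain ⟨z, hz⟩ := exists_smul_mem_of_mem_invariantCore hω
    have h := (hmem _ hz).1.2.2.1 (z * x) (((hG z ω).1 x).1 hx)
    refine (h.preimage (mul_right_injective z).injOn).subset fun y hy => ?_
    exact ((hG z ω).2 x y).1 hy
  · intro ω hω
    obtain ⟨z, hz⟩ := exists_smul_mem_of_mem_invariantCore hω
    ext x
    rw [(hG z ω).1 x, (hmem _ hz).1.2.2.2, hfa.mul_mem_points_smul]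
  · exact fun ω hω x y => mem_averagedSet_iff (r := fun ω x y => (G ω).Adj x y)
      (fun z ω x y => (hG z ω).2 x y) hF hω x y
  · have h0 : P (invariantCore haar Bᶜ)ᶜ = 0 :=
      measure_compl_invariantCore hBm.compl (by rwa [compl_compl])
    refine palm_eq_zero_of_invariant hm hw (measurableSet_invariantCore hBm.compl).compl ?_ h0
    exact fun x ω h h' => h (smul_mem_invariantCore x h')

end GraphOnPoints

/-! ### The network of displacements -/

section PointNetwork

variable {X : Type u} [Group X] [TopologicalSpace X] [IsTopologicalGroup X]
  [LocallyCompactSpace X] [SecondCountableTopology X] [T2Space X]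
  [MeasurableSpace X] [BorelSpace X] {Ξ : Type u} [MetricSpace Ξ] (c : Ξ ≃ₜ X)

/-- A graph on points of a group as a network: the mark of the edge from `x` to `y` is `x⁻¹ y`. -/
def pointNetwork (H : (⊤ : SimpleGraph X).Subgraph) (hc : H.coe.Connected)
    (hf : ∀ x ∈ H.verts, (H.neighborSet x).Finite) : Network Ξ where
  V := H.verts
  graph := H.coe
  connected := hc
  locallyFinite v := by
    refine ((hf v v.2).preimage Subtype.val_injective.injOn).subset fun w hw => ?_
    exact hw
  vertexMark _ := c.symm 1
  edgeMark x y := c.symm ((x : X)⁻¹ * y)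

/-- The network with one vertex. -/
def trivialNetwork : Network Ξ where
  V := PUnit
  graph := ⊥
  connected := by
    rw [SimpleGraph.connected_iff]
    exact ⟨SimpleGraph.preconnected_bot_iff_subsingleton.2 inferInstance, inferInstance⟩
  locallyFinite _ := toFinite _
  vertexMark _ := c.symm 1
  edgeMark _ _ := c.symm 1

variable {H : (⊤ : SimpleGraph X).Subgraph} {hc : H.coe.Connected}
  {hf : ∀ x ∈ H.verts, (H.neighborSet x).Finite}

/-- Displacements telescope: `(x⁻¹ * z) * (z⁻¹ * y) = x⁻¹ * y`. -/
theorem walkProd_pointNetwork {x y : H.verts} (p : (pointNetwork c H hc hf).graph.Walk x y) :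
    (pointNetwork c H hc hf).walkProd c p = (x : X)⁻¹ * y := by
  induction p with
  | nil => exact (inv_mul_cancel _).symm
  | cons h p ih =>
    change c (c.symm _) * _ = _
    rw [ih, Homeomorph.apply_symm_apply, mul_assoc, mul_inv_cancel_left]

theorem consistent_pointNetwork : (pointNetwork c H hc hf).Consistent c := by
  intro x y p q
  exact (walkProd_pointNetwork c p).trans (walkProd_pointNetwork c q).symm

theorem transport_pointNetwork (x y : H.verts) :
    (pointNetwork c H hc hf).transport c x y = (x : X)⁻¹ * y := by
  obtain ⟨p⟩ := (pointNetwork c H hc hf).connected.preconnected x y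
  rw [(consistent_pointNetwork c).transport_eq p, walkProd_pointNetwork]

/-- From a root at `1`, the transport to a vertex is its own position, so the image measure recovers
the configuration. -/
theorem transportMeasure_pointNetwork {μ : CountingMeasure X} (hμ : IsSimple μ)
    (hH : H.verts = points μ) {o : H.verts} (ho : (o : X) = 1) :
    transportMeasure c (rooted (pointNetwork c H hc hf) o) = (μ : Measure X) := by
  refine (transportMeasure_rooted c.continuous _ _).trans ?_
  rw [hμ.eq_sum_dirac]
  ext B hB
  rw [Measure.sum_apply _ hB, Measure.sum_apply _ hB,
    ← Equiv.tsum_eq (Equiv.setCongr hH) (fun x : points μ => Measure.dirac (x : X) B)]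
  refine tsum_congr fun v => congrArg (fun x => Measure.dirac x B) ?_
  refine (transport_pointNetwork c o v).trans ?_
  rw [ho, inv_one, one_mul]
  rfl

theorem rooted_pointNetwork_mem_embeddableClasses {μ : CountingMeasure X} (hμ : IsSimple μ)
    (hH : H.verts = points μ) {o : H.verts} (ho : (o : X) = 1) :
    rooted (pointNetwork c H hc hf) o ∈ embeddableClasses c := by
  refine ⟨(rooted_mem_consistentClasses _).2 (consistent_pointNetwork c), ?_⟩
  rw [mem_ofPred_eq, transportMeasure_pointNetwork c hμ hH ho]
  exact μ.2.1

end PointNetwork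

/-! ### The random network under the Palm measure -/

section RandomNetwork

variable {X : Type u} [Group X] [TopologicalSpace X] [IsTopologicalGroup X]
  [LocallyCompactSpace X] [SecondCountableTopology X] [T2Space X]
  [MeasurableSpace X] [BorelSpace X]
  {Ω : Type v} [MeasurableSpace Ω] [MulAction X Ω] [MeasurableSMul₂ X Ω]
  {Ξ : Type u} [MetricSpace Ξ] (c : Ξ ≃ₜ X)
  {m : Ω → CountingMeasure X} {G : Ω → (⊤ : SimpleGraph X).Subgraph} {A : Set Ω}
  {E : Set (Ω × X × X)}

/-- The good configurations with a point at the neutral element. -/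
def rootedEvent (m : Ω → CountingMeasure X) (A : Set Ω) : Set Ω :=
  A ∩ {ω | (1 : X) ∈ points (m ω)}

/-- The good configurations with points at the neutral element and at `x`. -/
def birootedEvent (m : Ω → CountingMeasure X) (A : Set Ω) : Set (Ω × X) :=
  {p | p.1 ∈ rootedEvent m A ∧ p.2 ∈ points (m p.1)}

namespace IsGoodEvent

theorem measurableSet_rootedEvent (h : IsGoodEvent m G A E) (hm : Measurable m) : MeasurableSet (rootedEvent m A) :=
  h.measurableSet.inter (measurableSet_mem_points hm measurable_id measurable_const)

theorem measurableSet_birootedEvent (h : IsGoodEvent m G A E) (hm : Measurable m) : MeasurableSet (birootedEvent m A) :=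
  (measurable_fst (h.measurableSet_rootedEvent hm)).inter
    (measurableSet_mem_points hm measurable_fst measurable_snd)

theorem one_mem_verts (h : IsGoodEvent m G A E) {ω : Ω} (hω : ω ∈ rootedEvent m A) : (1 : X) ∈ (G ω).verts := by
  rw [h.verts_eq ω hω.1]
  exact hω.2

theorem connected (h : IsGoodEvent m G A E) {ω : Ω} (hω : ω ∈ rootedEvent m A) : (G ω).coe.Connected := by
  rw [SimpleGraph.connected_iff]
  exact ⟨h.preconnected ω hω.1, ⟨1, h.one_mem_verts hω⟩⟩

/-- The network on the points of a good configuration. -/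
def network (h : IsGoodEvent m G A E) {ω : Ω} (hω : ω ∈ rootedEvent m A) : Network Ξ :=
  pointNetwork c (G ω) (h.connected hω) (h.finite ω hω.1)

/-- Left translation preserves adjacency by equivariance of the graph, and it preserves the
displacements `a⁻¹ * b`. -/
theorem isoMarks (h : IsGoodEvent m G A E) {ω : Ω} (hω : ω ∈ rootedEvent m A) {z : X} (hz : z • ω ∈ rootedEvent m A)
    (v w : (G ω).verts) : birooted (h.network c hω) v w =
      birooted (h.network c hz) (h.equivariant.iso z ω v) (h.equivariant.iso z ω w) := by
  refine birooted_eq_of_iso (G := h.network c hω) (H := h.network c hz)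
    (h.equivariant.iso z ω) (fun _ => rfl) (fun (a b : (G ω).verts) _ => ?_) v w
  change c.symm ((a : X)⁻¹ * b) = c.symm ((z * (a : X))⁻¹ * (z * b))
  rw [mul_inv_rev, mul_assoc, inv_mul_cancel_left]

/-- The network with roots at the neutral element and at `x`. -/
def birootedClass (h : IsGoodEvent m G A E) (s : birootedEvent m A) : NetworkClass Ξ 2 :=
  birooted (h.network c s.2.1) ⟨1, h.one_mem_verts s.2.1⟩
    ⟨s.1.2, (h.verts_eq s.1.1 s.2.1.1).symm ▸ s.2.2⟩

theorem measurable_birootedClass (h : IsGoodEvent m G A E) [TopologicalSpace.SeparableSpace Ξ] (hm : Measurable m) :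
    Measurable (h.birootedClass c) := by
  let _ : MeasurableSpace Ξ := borel Ξ
  have : BorelSpace Ξ := ⟨rfl⟩
  have hEm : MeasurableSet {p : birootedEvent m A × X × X | (p.1.1.1, p.2.1, p.2.2) ∈ E} :=
    (show Measurable fun p : birootedEvent m A × X × X => (p.1.1.1, p.2.1, p.2.2) by fun_prop)
      h.measurableSet_edges
  refine measurable_networkClass (μ := fun s : birootedEvent m A => m s.1.1)
    (hm.comp (measurable_fst.comp measurable_subtype_coe)) hEm
    (r := ![fun _ => 1, fun s => s.1.2]) (e := fun x y => c.symm (x⁻¹ * y)) (fun l => ?_) ?_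
    (fun s => PointedNetwork.mk (h.network c s.2.1) ![⟨1, h.one_mem_verts s.2.1⟩,
      ⟨s.1.2, (h.verts_eq s.1.1 s.2.1.1).symm ▸ s.2.2⟩])
    (fun s => Subtype.val) (fun s => Subtype.val_injective) (fun s => ?_) (fun s v w => ?_)
    (fun s l => ?_) (fun _ _ _ => rfl) (ξ := c.symm 1) (fun _ _ => rfl)
  · fin_cases l
    · exact measurable_const
    · exact measurable_snd.comp measurable_subtype_coe
  · exact c.symm.continuous.measurable.comp
      (show Measurable fun p : X × X => p.1⁻¹ * p.2 by fun_prop)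
  · exact Subtype.range_coe.trans (h.verts_eq s.1.1 s.2.1.1)
  · exact (h.adj_iff s.1.1 s.2.1.1 _ _).symm
  · fin_cases l <;> rfl

open Classical in
/-- The network seen from the neutral element. -/
noncomputable def rootedClass (h : IsGoodEvent m G A E) (ω : Ω) : NetworkClass Ξ 1 :=
  if hω : ω ∈ rootedEvent m A then rooted (h.network c hω) ⟨1, h.one_mem_verts hω⟩
  else rooted (trivialNetwork c) PUnit.unit

theorem rootedClass_of_mem (h : IsGoodEvent m G A E) {ω : Ω} (hω : ω ∈ rootedEvent m A) :
    h.rootedClass c ω = rooted (h.network c hω) ⟨1, h.one_mem_verts hω⟩ := dif_pos hω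

theorem measurable_rootedClass (h : IsGoodEvent m G A E) [TopologicalSpace.SeparableSpace Ξ] (hm : Measurable m) :
    Measurable (h.rootedClass c) := by
  classical
  refine Measurable.dite (s := rootedEvent m A)
    (f := fun ω => rooted (h.network c ω.2) ⟨1, h.one_mem_verts ω.2⟩)
    (g := fun _ => rooted (trivialNetwork c) PUnit.unit) ?_ measurable_const
    (h.measurableSet_rootedEvent hm)
  have hpair : Measurable fun ω : rootedEvent m A =>
      (⟨(ω.1, 1), ω.2, ω.2.2⟩ : birootedEvent m A) :=
    Measurable.subtype_mk (measurable_subtype_coe.prodMk measurable_const)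
  exact continuous_forget.measurable.comp ((h.measurable_birootedClass c hm).comp hpair)

open Classical in
/-- A function of birooted networks as a function of configurations and points. -/
noncomputable def massFunction (h : IsGoodEvent m G A E) (g : NetworkClass Ξ 2 → ℝ≥0∞) (ω : Ω) (x : X) : ℝ≥0∞ :=
  if hs : (ω, x) ∈ birootedEvent m A then g (h.birootedClass c ⟨(ω, x), hs⟩) else 0

theorem measurable_massFunction (h : IsGoodEvent m G A E) [TopologicalSpace.SeparableSpace Ξ] (hm : Measurable m)
    {g : NetworkClass Ξ 2 → ℝ≥0∞} (hg : Measurable g) :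
    Measurable (Function.uncurry (h.massFunction c g)) := by
  classical
  exact Measurable.dite (s := birootedEvent m A) (f := fun s => g (h.birootedClass c s))
    (g := fun _ => 0) (hg.comp (h.measurable_birootedClass c hm)) measurable_const
    (h.measurableSet_birootedEvent hm)

theorem massOut_rootedClass (h : IsGoodEvent m G A E) [TopologicalSpace.SeparableSpace Ξ] (hm : Measurable m)
    {g : NetworkClass Ξ 2 → ℝ≥0∞} (hg : Measurable g) {ω : Ω} (hω : ω ∈ rootedEvent m A) :
    massOut g (h.rootedClass c ω) = ∫⁻ x, h.massFunction c g ω x ∂(m ω : Measure X) := by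
  have hmeas : Measurable fun x => h.massFunction c g ω x :=
    (h.measurable_massFunction c hm hg).comp measurable_prodMk_left
  rw [(h.simple ω hω.1).lintegral_eq_tsum hmeas, h.rootedClass_of_mem c hω,
    ← Equiv.tsum_eq (Equiv.setCongr (h.verts_eq ω hω.1))]
  refine (massOut_rooted _ _ _).trans ?_
  refine tsum_congr fun (v : (G ω).verts) => ?_
  have hs : (ω, (v : X)) ∈ birootedEvent m A := ⟨hω, h.verts_eq ω hω.1 ▸ v.2⟩
  change _ = h.massFunction c g ω v
  rw [massFunction, dif_pos hs]
  rfl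

theorem inv_smul_mem_rootedEvent (h : IsGoodEvent m G A E) (hfa : FlowAdapted m) {ω : Ω} (hω : ω ∈ rootedEvent m A) {x : X}
    (hx : x ∈ points (m ω)) : x⁻¹ • ω ∈ rootedEvent m A := by
  refine ⟨h.smul_mem _ _ hω.1, ?_⟩
  have := (hfa.mul_mem_points_smul x⁻¹ ω x).2 hx
  rwa [inv_mul_cancel] at this

/-- For a vertex `v`, translation by `v⁻¹` turns the roots `(v, 1)` into `(1, v⁻¹)`. The incoming
mass is thus the same mass function, evaluated at the configuration seen from `v`. -/
theorem massIn_rootedClass (h : IsGoodEvent m G A E) [TopologicalSpace.SeparableSpace Ξ] (hm : Measurable m)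
    (hfa : FlowAdapted m) {g : NetworkClass Ξ 2 → ℝ≥0∞} (hg : Measurable g) {ω : Ω}
    (hω : ω ∈ rootedEvent m A) :
    massIn g (h.rootedClass c ω) =
      ∫⁻ x, h.massFunction c g (x⁻¹ • ω) x⁻¹ ∂(m ω : Measure X) := by
  have hmeas : Measurable fun x => h.massFunction c g (x⁻¹ • ω) x⁻¹ :=
    (h.measurable_massFunction c hm hg).comp (f := fun x : X => (x⁻¹ • ω, x⁻¹)) (by fun_prop)
  rw [(h.simple ω hω.1).lintegral_eq_tsum hmeas, h.rootedClass_of_mem c hω,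
    ← Equiv.tsum_eq (Equiv.setCongr (h.verts_eq ω hω.1))]
  refine (massIn_rooted _ _ _).trans ?_
  refine tsum_congr fun (v : (G ω).verts) => ?_
  have hv : (v : X) ∈ points (m ω) := h.verts_eq ω hω.1 ▸ v.2
  have hz := h.inv_smul_mem_rootedEvent hfa hω hv
  have hs : ((v : X)⁻¹ • ω, (v : X)⁻¹) ∈ birootedEvent m A := by
    refine ⟨hz, ?_⟩
    have := (hfa.mul_mem_points_smul (v : X)⁻¹ ω 1).2 hω.2
    rwa [mul_one] at this
  refine Eq.trans ?_ (dif_pos hs).symm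
  rw [h.isoMarks c hω hz]
  refine congrArg g ?_
  unfold birootedClass
  congr 1
  · exact Subtype.ext (inv_mul_cancel _)
  · exact Subtype.ext (mul_one _)

/-- Outgoing and incoming mass are the two sides of `palm_exchange` for the mass function of `g`. -/
theorem isUnimodularNetwork (h : IsGoodEvent m G A E) [TopologicalSpace.SeparableSpace Ξ] {P : Measure Ω} [SFinite P]
    [SMulInvariantMeasure X Ω P] {haar : Measure X} [haar.IsHaarMeasure]
    [haar.IsMulRightInvariant] (hm : Measurable m) (hfa : FlowAdapted m)
    [IsLocallyFiniteMeasure (meanMeasure P m)] (h0 : meanMeasure P m ≠ 0)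
    {w : X → ℝ≥0} (hw : Measurable w) (hw1 : ∫⁻ x, (w x : ℝ≥0∞) ∂haar = 1)
    (hA : ∀ᵐ ω ∂(palm P haar m w), ω ∈ rootedEvent m A) :
    IsUnimodularNetwork (palm P haar m w) (h.rootedClass c) := by
  refine ⟨isProbabilityMeasure_palm hm hfa h0 hw hw1, h.measurable_rootedClass c hm,
    fun g hg => ?_⟩
  have hout : ∀ᵐ ω ∂(palm P haar m w), massOut g (h.rootedClass c ω) =
      ∫⁻ x, h.massFunction c g ω x ∂(m ω : Measure X) := by
    filter_upwards [hA] with ω hω using h.massOut_rootedClass c hm hg hω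
  have hin : ∀ᵐ ω ∂(palm P haar m w), massIn g (h.rootedClass c ω) =
      ∫⁻ x, h.massFunction c g (x⁻¹ • ω) x⁻¹ ∂(m ω : Measure X) := by
    filter_upwards [hA] with ω hω using h.massIn_rootedClass c hm hfa hg hω
  rw [lintegral_congr_ae hout, lintegral_congr_ae hin]
  exact palm_exchange hm hfa hw hw1 (h.measurable_massFunction c hm hg)

theorem rootedClass_mem_embeddableClasses (h : IsGoodEvent m G A E) {ω : Ω} (hω : ω ∈ rootedEvent m A) :
    h.rootedClass c ω ∈ embeddableClasses c := by
  rw [h.rootedClass_of_mem c hω]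
  exact rooted_pointNetwork_mem_embeddableClasses c (h.simple ω hω.1) (h.verts_eq ω hω.1) rfl

theorem embedding_rootedClass (h : IsGoodEvent m G A E) {ω : Ω} (hω : ω ∈ rootedEvent m A) :
    embedding c.continuous (h.rootedClass c ω) = m ω := by
  refine Subtype.ext ?_
  rw [coe_embedding c.continuous (h.rootedClass_mem_embeddableClasses c hω),
    h.rootedClass_of_mem c hω]
  exact transportMeasure_pointNetwork c (h.simple ω hω.1) (h.verts_eq ω hω.1) rfl

/-- `H` is an arbitrary representative of the class. An isomorphism onto the concrete network
identifies the transition with the position of the image vertex, hence with a bijection onto the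
points. -/
theorem bijOn_transition (h : IsGoodEvent m G A E) {ω : Ω} (hω : ω ∈ rootedEvent m A) {H : Network Ξ} {o : H.V}
    (hH : h.rootedClass c ω = rooted H o) :
    BijOn (fun v => transition c (birooted H o v)) univ
      (points (embedding c.continuous (h.rootedClass c ω))) := by
  have hmem := h.rootedClass_mem_embeddableClasses c hω
  rw [h.embedding_rootedClass c hω, ← h.verts_eq ω hω.1]
  have hiso := hH.symm.trans (h.rootedClass_of_mem c hω)
  obtain ⟨φ, -, h2, h3⟩ := exists_iso_of_rooted_eq hiso
  let f : H.V → (G ω).verts := φ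
  have ht : (fun v => transition c (birooted H o v)) = fun v => (f v : X) := by
    ext1 v
    rw [transition_birooted (hH ▸ hmem), Network.transport_eq_of_iso φ h2, h3]
    refine (transport_pointNetwork c _ _).trans ?_
    rw [inv_one, one_mul]
  rw [ht]
  refine ⟨fun v _ => (f v).2, fun v _ w _ hvw => φ.injective (Subtype.ext hvw), fun x hx => ?_⟩
  obtain ⟨v, hv⟩ := φ.surjective (⟨x, hx⟩ : (G ω).verts)
  exact ⟨v, mem_univ _, congrArg (fun y : (G ω).verts => (y : X)) hv⟩

end IsGoodEvent

end RandomNetwork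

end PalmNetwork

theorem mainTheorem10
    {X : Type u} [Group X] [TopologicalSpace X] [IsTopologicalGroup X]
    [LocallyCompactSpace X] [SecondCountableTopology X] [T2Space X]
    [MeasurableSpace X] [BorelSpace X]
    (haar : Measure X) [haar.IsHaarMeasure]
    (unimodular : ∀ (x : X) (B : Set X), MeasurableSet B → haar ((fun y => y * x) '' B) = haar B)
    {Ω : Type v} [MeasurableSpace Ω] (P : Measure Ω) [IsProbabilityMeasure P]
    [MulAction X Ω] [MeasurableSMul₂ X Ω] [SMulInvariantMeasure X Ω P]
    (m : Ω → CountingMeasure X) (measurable_m : Measurable m)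
    (flowAdapted : FlowAdapted m) (simple : ∀ᵐ ω ∂P, IsSimple (m ω))
    (locallyFinite : IsLocallyFiniteMeasure (meanMeasure P m)) (nonzero : meanMeasure P m ≠ 0)
    (connectible : Connectible P m)
    (w : X → ℝ≥0) (measurable_w : Measurable w) (integral_w : ∫⁻ x, (w x : ℝ≥0∞) ∂haar = 1) :
    ∃ (Ξ : Type u) (_ : MetricSpace Ξ) (_ : CompleteSpace Ξ)
      (_ : TopologicalSpace.SeparableSpace Ξ) (Γ : Ω → NetworkClass Ξ 1),
      IsUnimodularNetwork (palm P haar m w) Γ ∧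
      ∃ ψ : NetworkClass Ξ 1 → CountingMeasure X,
        IsEmbedding (palm P haar m w) Γ ψ ∧ ∀ᵐ ω ∂(palm P haar m w), m ω = ψ (Γ ω) := by
  have hright := isMulRightInvariant_of_image unimodular
  obtain ⟨G, A, E, h, hA⟩ := exists_isGoodEvent (haar := haar) measurable_m flowAdapted simple
    connectible measurable_w
  have hroot : ∀ᵐ ω ∂(palm P haar m w), ω ∈ rootedEvent m A :=
    hA.and (palm_one_mem_points measurable_m flowAdapted measurable_w)
  -- The mark space is the group with a compatible complete metric; forgetting all but a
  -- homeomorphism keeps the metric structure apart from the given topology.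
  obtain ⟨Ξ, mΞ, hcomplete, hsep, ⟨c⟩⟩ : ∃ (Ξ : Type u) (_ : MetricSpace Ξ) (_ : CompleteSpace Ξ)
      (_ : TopologicalSpace.SeparableSpace Ξ), Nonempty (Ξ ≃ₜ X) := by
    have := isCompletelyMetrizableSpace_of_locallyCompact_group X
    let _ := TopologicalSpace.upgradeIsCompletelyMetrizable X
    exact ⟨X, inferInstance, inferInstance, inferInstance, ⟨Homeomorph.refl X⟩⟩
  refine ⟨Ξ, mΞ, hcomplete, hsep, h.rootedClass c, h.isUnimodularNetwork c measurable_m flowAdapted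
    nonzero measurable_w integral_w hroot, embedding c.continuous, ⟨measurable_embedding _,
    one_mem_points_embedding _, transition c, measurable_transition c.continuous,
    fun K o v => ⟨embedding_rooted_eq_leftTranslate _ K o v, transition_symm c.continuous K o v⟩,
    ?_⟩, ?_⟩
  · filter_upwards [hroot] with ω hω K o hK using h.bijOn_transition c hω hK
  · filter_upwards [hroot] with ω hω using (h.embedding_rootedClass c hω).symm
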